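/- Let $\sigma$ be a symplectic form on $\mathbb C^4$ (a nondegenerate alternating bilinear form, with constant coefficients), let $R=\sum_{i=0}^3 x_i\,\partial/\partial x_i$ be the radial vector field, and let $\omega=i_R\sigma$ be the associated contact form on $\mathbb P^3=\mathbb P(\mathbb C^4)$. A line $L\subset\mathbb P^3$ is called involutive if the restriction of $\omega$ to $L$ vanishes identically, equivalently if $L$ is the projectivization of a Lagrangian plane of $(\mathbb C^4,\sigma)$. Let $\ell_i(d)\in\mathbb N\cup\{\infty\}$ be the supremum of the numbers of involutive lines contained in a smooth surface of degree $d$ in $\mathbb P^3$. (1) If $d\ge 3$, then every smooth surface $X\subset\mathbb P^3$ of degree $d$ contains at most $3d^2-4d$ involutive lines. (2) For every $d\ge 3$, $d^2\le \ell_i(d)\le 3d^2-4d$, and $$\limsup_{d\to\infty}\frac{\ell_i(d)}{d^2}\in[1,3].$$ (3) If $\sigma=dx_0\wedge dx_1+dx_2\wedge dx_3$, $d\ge 3$, and $p,q$ are binary forms of degree $d$ over $\mathbb C$ such that the surface $\{p(x_0,x_1)+q(x_2,x_3)=0\}\subset\mathbb P^3$ is smooth of degree $d$, then this surface contains at least $d^2$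 lines that are involutive with respect to $\omega=i_R\sigma$. -/

import Mathlib

open scoped LinearAlgebra.Projectivization ENNReal

namespace InvolutiveLines

/-- The vector space `ℂ⁴` with coordinates `x₀, x₁, x₂, x₃`. -/
abbrev V : Type := Fin 4 → ℂ

/-- Complex projective three-space, the space of one-dimensional subspaces of `ℂ⁴`. -/
abbrev P3 : Type := ℙ ℂ V

/-- The zero locus in `ℙ³` of a polynomial `F`; only used for homogeneous `F`, for which it does
not depend on the representatives (see `mk_mem_zeroLocus_iff`). -/
def zeroLocus (F : MvPolynomial (Fin 4) ℂ) : Set P3 :=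
  {x | MvPolynomial.eval x.rep F = 0}

theorem mk_mem_zeroLocus_iff {F : MvPolynomial (Fin 4) ℂ} {d : ℕ} (hF : F.IsHomogeneous d)
    (v : V) (hv : v ≠ 0) :
    Projectivization.mk ℂ v hv ∈ zeroLocus F ↔ MvPolynomial.eval v F = 0 := by
  obtain ⟨a, ha⟩ := Projectivization.exists_smul_eq_mk_rep ℂ v hv
  have h : MvPolynomial.eval ((a : ℂ) • v) F = (a : ℂ) ^ d * MvPolynomial.eval v F := by
    rw [MvPolynomial.eval_eq, MvPolynomial.eval_eq, Finset.mul_sum]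
    refine Finset.sum_congr rfl fun m hm => ?_
    have hd : ∑ i, m i = d := by
      have := hF (MvPolynomial.mem_support_iff.mp hm)
      rw [Finsupp.weight_apply, Finsupp.sum_fintype _ _ (by simp)] at this
      simpa using this
    have hp : ∏ i ∈ m.support, (a : ℂ) ^ m i = (a : ℂ) ^ d := by
      rw [Finset.prod_pow_eq_pow_sum, ← hd]
      congr 1
      exact Finset.sum_subset (Finset.subset_univ _) (by simp)
    simp only [Pi.smul_apply, smul_eq_mul, mul_pow, Finset.prod_mul_distrib, hp]
    ring
  have h' : (Projectivization.mk ℂ v hv).rep = (a : ℂ) • v := ha.symm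
  simp [zeroLocus, h', h]

/-- `F` is a homogeneous polynomial of degree `d` whose gradient does not vanish at any nonzero
zero of `F`. -/
def IsNonsingularForm (d : ℕ) (F : MvPolynomial (Fin 4) ℂ) : Prop :=
  F.IsHomogeneous d ∧
    ∀ v : V, v ≠ 0 → MvPolynomial.eval v F = 0 →
      ∃ i, MvPolynomial.eval v (MvPolynomial.pderiv i F) ≠ 0

/-- `X ⊂ ℙ³` is a smooth surface of degree `d`. -/
def IsSmoothSurface (d : ℕ) (X : Set P3) : Prop :=
  ∃ F : MvPolynomial (Fin 4) ℂ, IsNonsingularForm d F ∧ X = zeroLocus F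

/-- A constant symplectic form on `ℂ⁴`: an alternating nondegenerate bilinear form. -/
def IsSymplectic (σ : LinearMap.BilinForm ℂ V) : Prop :=
  σ.IsAlt ∧ σ.Nondegenerate

/-- The contact form `ω = i_R σ`, where `R = ∑ xᵢ ∂/∂xᵢ` is the radial vector field: its value at
the point with homogeneous coordinates `v` is the covector `w ↦ σ (R v, w) = σ (v, w)`. -/
def contactForm (σ : LinearMap.BilinForm ℂ V) (v : V) : Module.Dual ℂ V :=
  σ v

/-- `L ⊂ ℙ³` is a line: a projective linear subspace whose cone is a plane in `ℂ⁴`. -/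
def IsLine (L : Projectivization.Subspace ℂ V) : Prop :=
  Module.finrank ℂ (Projectivization.Subspace.submodule L) = 2

/-- `L` is an involutive line: a line on which the contact form vanishes, that is, at every point
of the cone over `L` the form is zero on all vectors tangent to the cone. Equivalently, the cone
over `L` is a Lagrangian plane. -/
def IsInvolutiveLine (σ : LinearMap.BilinForm ℂ V) (L : Projectivization.Subspace ℂ V) : Prop :=
  IsLine L ∧
    ∀ v ∈ Projectivization.Subspace.submodule L, ∀ w ∈ Projectivization.Subspace.submodule L,
      contactForm σ v w = 0

/-- The set of involutive lines contained in `X`. -/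
def involutiveLines (σ : LinearMap.BilinForm ℂ V) (X : Set P3) :
    Set (Projectivization.Subspace ℂ V) :=
  {L | IsInvolutiveLine σ L ∧ (L : Set P3) ⊆ X}

/-- `ℓᵢ(d)`: the largest number of involutive lines that a smooth surface of degree `d` in `ℙ³` can
have, as an element of `ℕ ∪ {∞}`. -/
noncomputable def maxInvolutiveLines (σ : LinearMap.BilinForm ℂ V) (d : ℕ) : ℕ∞ :=
  ⨆ (X : Set P3) (_ : IsSmoothSurface d X), (involutiveLines σ X).encard

/-- The symplectic form `dx₀ ∧ dx₁ + dx₂ ∧ dx₃`. -/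
noncomputable def standardForm : LinearMap.BilinForm ℂ V :=
  Matrix.toBilin' !![0, 1, 0, 0; -1, 0, 0, 0; 0, 0, 0, 1; 0, 0, -1, 0]

/-- The polynomial `p(x₀, x₁) + q(x₂, x₃)`. -/
noncomputable def binarySum (p q : MvPolynomial (Fin 2) ℂ) : MvPolynomial (Fin 4) ℂ :=
  MvPolynomial.rename ![0, 1] p + MvPolynomial.rename ![2, 3] q

end InvolutiveLines

/-!
A form `F` defining a smooth surface has a Hamiltonian vector field `v`, given by `σ(v, ·) = dF`.
At a point `x` of the surface, `x` and `v(x)` are orthogonal for `σ`, and a Lagrangian plane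
contained in the cone over the surface is its own orthogonal, so it contains `v(x)` for each of its
points `x` (`hamAt_mem_of_lagrangian`). Hence `v` is an asymptotic direction of the surface along
every involutive line: with `D` the derivative along `v`, the form `G = dF (D v)` of degree `3d - 4`
vanishes on it (`inflection_eq_zero_of_lagrangian`). If `F` does not divide `G`, Bézout's inequality
for lines (`card_lines_le`) bounds the number of involutive lines by `d (3d - 4)`. That inequality
is proved by projecting from a general point: the eliminant of `F` and `G` is a ternary form of
degree `deg F * deg G` divisible by the equations of the projected lines. It needs `F` to be prime,
which holds because a proper factorisation makes the surface singular at a common zero of the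
factors (`IsNonsingularForm.prime`).

That `F` does not divide `G` when `d ≥ 3` (`not_dvd_inflection`) is seen as follows. Suppose
that it does. Then on the surface `D v` is orthogonal to `x` and to `v`, hence a combination of
them, and the integral curves of `v` are lines contained in the surface
(`dvd_coeff_hamExpand`). On each of these lines the binary form `x ∧ v` of degree `d` has a zero,
that is, a point where `v` is radial, which can be rescaled to a solution of `v(z) = z`
because `d ≥ 3`; all points of the line are orthogonal to `z`. The system `v(z) = z` has no solution
at infinity, so it has finitely many solutions (`finite_fixedPoints`), and the surface is covered
by the finitely many planes orthogonal to them. Being irreducible of degree at least three,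
it cannot be.

For the lower bound, smoothness of `p(x₀, x₁) + q(x₂, x₃)` forces `p` and `q` to have `d`
distinct zeros each (`exists_zeros_binary`), and the `d²` lines joining a zero of `p` to a zero of
`q` are involutive. Darboux bases (`exists_darboux`) transport both bounds between an arbitrary
symplectic form and the standard one.
-/

namespace InvolutiveLines

open MvPolynomial

/-! ### Homogeneous polynomials along lines -/

section Homogeneous

variable {ι : Type*} [Fintype ι]

theorem aeval_mul_of_isHomogeneous {B : Type*} [CommRing B] [Algebra ℂ B]
    {F : MvPolynomial ι ℂ} {d : ℕ} (hF : F.IsHomogeneous d) (b : B) (p : ι → B) :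
    aeval (fun i => b * p i) F = b ^ d * aeval p F := by
  rw [aeval_def, aeval_def, eval₂_eq', eval₂_eq', Finset.mul_sum]
  refine Finset.sum_congr rfl fun m hm => ?_
  have hd : ∑ i, m i = d := by
    have := hF (MvPolynomial.mem_support_iff.mp hm)
    rw [Finsupp.weight_apply, Finsupp.sum_fintype _ _ (by simp)] at this
    simpa using this
  simp only [mul_pow, Finset.prod_mul_distrib, Finset.prod_pow_eq_pow_sum, hd]
  ring

theorem eval_smul_of_isHomogeneous {F : MvPolynomial ι ℂ} {d : ℕ} (hF : F.IsHomogeneous d)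
    (a : ℂ) (v : ι → ℂ) : eval (a • v) F = a ^ d * eval v F := by
  have := aeval_mul_of_isHomogeneous hF a v
  rw [aeval_eq_eval] at this
  exact this

theorem eval_zero_of_isHomogeneous {F : MvPolynomial ι ℂ} {d : ℕ} (hF : F.IsHomogeneous d)
    (hd : d ≠ 0) : eval 0 F = 0 := by
  have := eval_smul_of_isHomogeneous hF 0 (0 : ι → ℂ)
  simpa [hd] using this

/-- Chain rule for a derivation applied to a polynomial expression. -/
theorem derivation_aeval {B : Type*} [CommRing B] [Algebra ℂ B] (δ : Derivation ℂ B B)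
    (p : ι → B) (F : MvPolynomial ι ℂ) :
    δ (aeval p F) = ∑ i, aeval p (pderiv i F) * δ (p i) := by
  classical
  induction F using MvPolynomial.induction_on with
  | C a => simp
  | add f g hf hg => simp [hf, hg, add_mul, Finset.sum_add_distrib]
  | mul_X f j hf =>
    have h : ∀ i, aeval p (pderiv i (f * X j)) * δ (p i)
        = p j * (aeval p (pderiv i f) * δ (p i))
          + if i = j then aeval p f * δ (p j) else 0 := by
      intro i
      rw [Derivation.leibniz, pderiv_X]
      by_cases hij : i = j
      · subst hij
        simp
        ring
      · simp [hij]
        ring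
    rw [Finset.sum_congr rfl fun i _ => h i, Finset.sum_add_distrib, ← Finset.mul_sum, ← hf]
    simp
    ring

/-- The restriction `t ↦ F (x + t v)` of a polynomial to a parametrised line. -/
noncomputable def lineRestrict (F : MvPolynomial ι ℂ) (x v : ι → ℂ) : Polynomial ℂ :=
  aeval (fun i => Polynomial.C (x i) + Polynomial.X * Polynomial.C (v i)) F

@[simp]
theorem eval_lineRestrict {ι : Type*} (F : MvPolynomial ι ℂ) (x v : ι → ℂ) (t : ℂ) :
    (lineRestrict F x v).eval t = eval (x + t • v) F := by
  rw [lineRestrict, ← Polynomial.coe_aeval_eq_eval, ← AlgHom.coe_toRingHom]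
  change (Polynomial.aeval t) (aeval _ F) = _
  rw [comp_aeval_apply, aeval_eq_eval]
  congr 2
  funext i
  simp only [map_add, map_mul, Polynomial.aeval_C, Polynomial.aeval_X, Algebra.algebraMap_self,
    RingHom.id_apply, Pi.add_apply, Pi.smul_apply, smul_eq_mul]

theorem derivative_lineRestrict (F : MvPolynomial ι ℂ) (x v : ι → ℂ) :
    (lineRestrict F x v).derivative
      = ∑ i, lineRestrict (pderiv i F) x v * Polynomial.C (v i) := by
  have := derivation_aeval (Polynomial.derivative' (R := ℂ))
    (fun i => Polynomial.C (x i) + Polynomial.X * Polynomial.C (v i)) F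
  simpa [lineRestrict] using this

theorem natDegree_lineRestrict_le {F : MvPolynomial ι ℂ} {d : ℕ} (hF : F.IsHomogeneous d)
    (x v : ι → ℂ) : (lineRestrict F x v).natDegree ≤ d := by
  rw [lineRestrict, aeval_def, eval₂_eq']
  refine Polynomial.natDegree_sum_le_of_forall_le _ _ fun m hm => ?_
  have hd : ∑ i, m i = d := by
    have := hF (MvPolynomial.mem_support_iff.mp hm)
    rw [Finsupp.weight_apply, Finsupp.sum_fintype _ _ (by simp)] at this
    simpa using this
  refine (Polynomial.natDegree_C_mul_le _ _).trans ((Polynomial.natDegree_prod_le _ _).trans ?_)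
  rw [← hd]
  refine Finset.sum_le_sum fun i _ => Polynomial.natDegree_pow_le.trans ?_
  refine (Nat.mul_le_mul_left _ (?_ : _ ≤ 1)).trans (mul_one _).le
  compute_degree

/-- The top coefficient of `t ↦ F (x + t v)` is `F v`: compare the two polynomials
`a ↦ F (a x + v)` and the reversal of the restriction, which agree for `a ≠ 0`. -/
theorem coeff_lineRestrict {F : MvPolynomial ι ℂ} {d : ℕ} (hF : F.IsHomogeneous d)
    (x v : ι → ℂ) : (lineRestrict F x v).coeff d = eval v F := by
  have hle := natDegree_lineRestrict_le hF x v
  have key : (lineRestrict F x v).reflect d = lineRestrict F v x := by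
    refine Polynomial.eq_of_infinite_eval_eq _ _ ?_
    refine (Set.finite_singleton (0 : ℂ)).infinite_compl.mono fun a (ha : a ≠ 0) => ?_
    let _ := invertibleOfNonzero (inv_ne_zero ha)
    have h := Polynomial.eval₂_reflect_mul_pow (RingHom.id ℂ) a⁻¹ d _ hle
    have h' : Polynomial.eval a (Polynomial.reflect d (lineRestrict F x v)) * a⁻¹ ^ d
        = Polynomial.eval a⁻¹ (lineRestrict F x v) := by
      have e : (⅟(a⁻¹) : ℂ) = a := by simp
      rw [e] at h
      exact h
    have h2 := eval_smul_of_isHomogeneous hF a⁻¹ (v + a • x)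
    rw [smul_add, smul_smul, inv_mul_cancel₀ ha, one_smul, add_comm] at h2
    rw [eval_lineRestrict, h2, mul_comm] at h'
    simp only [Set.mem_ofPred_eq, eval_lineRestrict]
    exact mul_left_cancel₀ (pow_ne_zero d (inv_ne_zero ha)) h'
  have h0 : (lineRestrict F v x).coeff 0 = eval v F := by
    simp [Polynomial.coeff_zero_eq_eval_zero]
  rw [← h0, ← key, Polynomial.coeff_reflect, Polynomial.revAt_le (Nat.zero_le d), Nat.sub_zero]

theorem eval_combination_eq_zero {F : MvPolynomial ι ℂ} {d : ℕ} (hF : F.IsHomogeneous d)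
    {x v : ι → ℂ} (h : ∀ t : ℂ, eval (x + t • v) F = 0) (a b : ℂ) :
    eval (a • x + b • v) F = 0 := by
  have h0 : lineRestrict F x v = 0 := Polynomial.funext fun t => by simp [h]
  by_cases ha : a = 0
  · have := coeff_lineRestrict hF x v
    rw [h0, Polynomial.coeff_zero] at this
    simp [ha, eval_smul_of_isHomogeneous hF, ← this]
  · have := eval_smul_of_isHomogeneous hF a (x + (a⁻¹ * b) • v)
    rw [h, mul_zero, smul_add, smul_smul, mul_inv_cancel_left₀ ha] at this
    exact this

/-- A form of positive degree has a nontrivial zero on every plane. -/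
theorem exists_combination_eval_eq_zero {F : MvPolynomial ι ℂ} {d : ℕ} (hF : F.IsHomogeneous d)
    (hd : d ≠ 0) (x v : ι → ℂ) :
    ∃ a b : ℂ, (a ≠ 0 ∨ b ≠ 0) ∧ eval (a • x + b • v) F = 0 := by
  by_cases hv : eval v F = 0
  · exact ⟨0, 1, by simp, by simp [hv]⟩
  · have hdeg : (lineRestrict F x v).degree ≠ 0 := by
      intro h
      have h1 := Polynomial.natDegree_eq_of_degree_eq_some h
      refine hv ?_
      rw [← coeff_lineRestrict hF x v]
      exact Polynomial.coeff_eq_zero_of_natDegree_lt (h1 ▸ Nat.pos_of_ne_zero hd)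
    obtain ⟨t, ht⟩ := IsAlgClosed.exists_root _ hdeg
    exact ⟨1, t, by simp, by simpa using ht⟩

theorem isHomogeneous_of_eval_smul {F : MvPolynomial ι ℂ} {d : ℕ}
    (h : ∀ (a : ℂ) (v : ι → ℂ), eval (a • v) F = a ^ d * eval v F) : F.IsHomogeneous d := by
  have hcomp : ∀ i, i ≠ d → homogeneousComponent i F = 0 := by
    intro i hi
    refine MvPolynomial.funext fun v => ?_
    have key : ∑ k ∈ Finset.range (F.totalDegree + 1),
        Polynomial.monomial k (eval v (homogeneousComponent k F))
        = Polynomial.monomial d (eval v F) := by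
      refine Polynomial.funext fun a => ?_
      have h1 := h a v
      conv_lhs at h1 => rw [← sum_homogeneousComponent F]
      simp only [map_sum,
        eval_smul_of_isHomogeneous (homogeneousComponent_isHomogeneous _ F)] at h1
      simp only [Polynomial.eval_finsetSum, Polynomial.eval_monomial]
      rw [mul_comm, ← h1]
      exact Finset.sum_congr rfl fun k _ => mul_comm _ _
    have hc := congrArg (Polynomial.coeff · i) key
    simp only [Polynomial.finsetSum_coeff, Polynomial.coeff_monomial, Finset.sum_ite_eq',
      if_neg hi.symm, Finset.mem_range] at hc
    by_cases hlt : i < F.totalDegree + 1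
    · simpa [hlt] using hc
    · rw [homogeneousComponent_eq_zero _ _ (by omega)]
  rw [← sum_homogeneousComponent F]
  refine IsHomogeneous.sum _ _ _ fun i _ => ?_
  by_cases hi : i = d
  · exact hi ▸ homogeneousComponent_isHomogeneous i F
  · rw [hcomp i hi]
    exact isHomogeneous_zero _ _ _

end Homogeneous

theorem homogeneousComponent_mul_top {ι : Type*} (P Q : MvPolynomial ι ℂ) :
    homogeneousComponent (P.totalDegree + Q.totalDegree) (P * Q)
      = homogeneousComponent P.totalDegree P * homogeneousComponent Q.totalDegree Q := by
  conv_lhs =>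
    enter [2]
    rw [← sum_homogeneousComponent P, ← sum_homogeneousComponent Q]
  rw [Finset.sum_mul_sum, map_sum]
  simp only [map_sum]
  have h : ∀ i j, homogeneousComponent (P.totalDegree + Q.totalDegree)
      (homogeneousComponent i P * homogeneousComponent j Q)
      = if P.totalDegree + Q.totalDegree = i + j then
        homogeneousComponent i P * homogeneousComponent j Q else 0 := fun i j =>
    homogeneousComponent_of_mem ((homogeneousComponent_isHomogeneous i P).mul
      (homogeneousComponent_isHomogeneous j Q))
  rw [Finset.sum_eq_single_of_mem P.totalDegree (by simp),
    Finset.sum_eq_single_of_mem Q.totalDegree (by simp), h, if_pos rfl]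
  · intro j hj hne
    rw [h, if_neg (by simp at hj; omega)]
  · intro i hi hne
    refine Finset.sum_eq_zero fun j hj => ?_
    rw [h, if_neg (by simp at hi hj; omega)]

/-! ### Linear forms and linear changes of coordinates -/

/-- The linear form on `ℂⁿ`, as a polynomial, attached to a linear functional. -/
noncomputable def linearForm {n : ℕ} (φ : Module.Dual ℂ (Fin n → ℂ)) : MvPolynomial (Fin n) ℂ :=
  ∑ i, C (φ (Pi.single i 1)) * X i

@[simp]
theorem eval_linearForm {n : ℕ} (φ : Module.Dual ℂ (Fin n → ℂ)) (v : Fin n → ℂ) :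
    eval v (linearForm φ) = φ v := by
  conv_rhs => rw [pi_eq_sum_univ' v]
  simp [linearForm, mul_comm]

theorem isHomogeneous_linearForm {n : ℕ} (φ : Module.Dual ℂ (Fin n → ℂ)) :
    (linearForm φ).IsHomogeneous 1 :=
  IsHomogeneous.sum _ _ _ fun i _ => by simpa using (isHomogeneous_X ℂ i).C_mul _

theorem linearForm_ne_zero {n : ℕ} {φ : Module.Dual ℂ (Fin n → ℂ)} (h : φ ≠ 0) :
    linearForm φ ≠ 0 := by
  intro h0
  refine h (LinearMap.ext fun v => ?_)
  rw [← eval_linearForm, h0]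
  simp

theorem prime_linearForm {n : ℕ} {φ : Module.Dual ℂ (Fin n → ℂ)} (h : φ ≠ 0) :
    Prime (linearForm φ) := by
  refine (irreducible_of_totalDegree_eq_one
    ((isHomogeneous_linearForm φ).totalDegree (linearForm_ne_zero h)) fun x hx => ?_).prime
  rw [isUnit_iff_ne_zero]
  rintro rfl
  exact linearForm_ne_zero h (MvPolynomial.ext _ _ fun m => by simpa using hx m)

/-- A polynomial vanishing on the zero set of a prime `P` is divisible by `P`. -/
theorem prime_dvd_of_eval_eq_zero {ι : Type*} [Finite ι] {P Q : MvPolynomial ι ℂ} (hP : Prime P)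
    (h : ∀ v, eval v P = 0 → eval v Q = 0) : P ∣ Q := by
  have : (Ideal.span {P}).IsPrime := (Ideal.span_singleton_prime hP.ne_zero).mpr hP
  rw [← Ideal.mem_span_singleton, ← IsPrime.vanishingIdeal_zeroLocus (K := ℂ) (Ideal.span {P}),
    mem_vanishingIdeal_iff]
  intro v hv
  rw [aeval_eq_eval]
  refine h v ?_
  have := hv P (Ideal.mem_span_singleton_self P)
  rwa [aeval_eq_eval] at this

/-- Substitution of a linear map of `ℂⁿ` into a polynomial: `(linSubst A F) v = F (A v)`. -/
noncomputable def linSubst {n : ℕ} (A : (Fin n → ℂ) →ₗ[ℂ] (Fin n → ℂ)) :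
    MvPolynomial (Fin n) ℂ →ₐ[ℂ] MvPolynomial (Fin n) ℂ :=
  aeval fun i => linearForm (LinearMap.proj i ∘ₗ A)

@[simp]
theorem eval_linSubst {n : ℕ} (A : (Fin n → ℂ) →ₗ[ℂ] (Fin n → ℂ)) (F : MvPolynomial (Fin n) ℂ)
    (v : Fin n → ℂ) : eval v (linSubst A F) = eval (A v) F := by
  rw [linSubst, ← aeval_eq_eval v, comp_aeval_apply, ← aeval_eq_eval]
  congr 2
  funext i
  simp [aeval_eq_eval]

theorem isHomogeneous_linSubst {n : ℕ} (A : (Fin n → ℂ) →ₗ[ℂ] (Fin n → ℂ))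
    {F : MvPolynomial (Fin n) ℂ} {d : ℕ} (hF : F.IsHomogeneous d) :
    (linSubst A F).IsHomogeneous d :=
  isHomogeneous_of_eval_smul fun a v => by simp [eval_smul_of_isHomogeneous hF]

/-- The substitution of an invertible linear map, as an automorphism of the polynomial ring. -/
noncomputable def linSubstEquiv {n : ℕ} (A : (Fin n → ℂ) ≃ₗ[ℂ] (Fin n → ℂ)) :
    MvPolynomial (Fin n) ℂ ≃ₐ[ℂ] MvPolynomial (Fin n) ℂ :=
  AlgEquiv.ofAlgHom (linSubst A.toLinearMap) (linSubst A.symm.toLinearMap)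
    (AlgHom.ext fun F => MvPolynomial.funext fun v => by simp)
    (AlgHom.ext fun F => MvPolynomial.funext fun v => by simp)

theorem linSubstEquiv_apply {n : ℕ} (A : (Fin n → ℂ) ≃ₗ[ℂ] (Fin n → ℂ))
    (F : MvPolynomial (Fin n) ℂ) : linSubstEquiv A F = linSubst A.toLinearMap F := rfl

/-- The derivative of `F ∘ A` at `v` in the direction `w` is that of `F` at `A v` in the
direction `A w`. -/
theorem sum_pderiv_linSubst {n : ℕ} (A : (Fin n → ℂ) →ₗ[ℂ] (Fin n → ℂ))
    (F : MvPolynomial (Fin n) ℂ) (v w : Fin n → ℂ) :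
    ∑ i, eval v (pderiv i (linSubst A F)) * w i
      = ∑ i, eval (A v) (pderiv i F) * A w i := by
  have h : lineRestrict (linSubst A F) v w = lineRestrict F (A v) (A w) :=
    Polynomial.funext fun t => by simp
  have := congrArg (fun p => Polynomial.eval 0 (Polynomial.derivative p)) h
  simpa [derivative_lineRestrict, Polynomial.eval_finsetSum] using this

/-! ### Elimination of one variable -/

/-- The result of eliminating the variable `X₀` from two forms of degrees `m` and `k`. -/
noncomputable def eliminant {n : ℕ} (m k : ℕ) (F G : MvPolynomial (Fin (n + 1)) ℂ) :
    MvPolynomial (Fin n) ℂ :=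
  Polynomial.resultant (finSuccEquiv ℂ n F) (finSuccEquiv ℂ n G) m k

section Eliminant

variable {n m k : ℕ} {F G : MvPolynomial (Fin (n + 1)) ℂ}

theorem natDegree_finSuccEquiv_le (hF : F.IsHomogeneous m) :
    (finSuccEquiv ℂ n F).natDegree ≤ m := by
  rw [natDegree_finSuccEquiv]
  exact (degreeOf_le_totalDegree F 0).trans hF.totalDegree_le

theorem coeff_finSuccEquiv_top (hF : F.IsHomogeneous m) :
    (finSuccEquiv ℂ n F).coeff m = C (eval (Fin.cons 1 0) F) := by
  have h0 := hF.finSuccEquiv_coeff_isHomogeneous m 0 (by simp)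
  rw [← totalDegree_zero_iff_isHomogeneous, totalDegree_eq_zero_iff_eq_C] at h0
  rw [h0]
  congr 1
  have h2 := coeff_lineRestrict hF 0 (Fin.cons 1 0)
  have h3 : lineRestrict F 0 (Fin.cons 1 0)
      = Polynomial.map (eval 0) (finSuccEquiv ℂ n F) := by
    refine Polynomial.funext fun t => ?_
    rw [← eval_eq_eval_mv_eval', eval_lineRestrict]
    congr 2
    funext i
    refine Fin.cases ?_ (fun j => ?_) i <;> simp
  rw [← h2, h3, Polynomial.coeff_map, h0]
  simp

theorem monic_finSuccEquiv (hF : F.IsHomogeneous m) (h1 : eval (Fin.cons 1 0) F = 1) :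
    (finSuccEquiv ℂ n F).Monic :=
  Polynomial.monic_of_natDegree_le_of_coeff_eq_one m (natDegree_finSuccEquiv_le hF)
    (by rw [coeff_finSuccEquiv_top hF, h1, C_1])

theorem natDegree_finSuccEquiv_eq (hF : F.IsHomogeneous m) (h1 : eval (Fin.cons 1 0) F = 1) :
    (finSuccEquiv ℂ n F).natDegree = m :=
  Polynomial.natDegree_eq_of_le_of_coeff_ne_zero (natDegree_finSuccEquiv_le hF)
    (by rw [coeff_finSuccEquiv_top hF, h1, C_1]; exact one_ne_zero)

/-- Over a point `y`, the eliminant is the product of the values of `G` at the points of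
`F = 0` above `y`. -/
theorem eval_eliminant (hF : F.IsHomogeneous m) (h1 : eval (Fin.cons 1 0) F = 1)
    (hG : G.IsHomogeneous k) (y : Fin n → ℂ) :
    eval y (eliminant m k F G) =
      (((finSuccEquiv ℂ n F).map (eval y)).roots.map
        fun z => eval (Fin.cons z y : Fin (n + 1) → ℂ) G).prod := by
  have hm := (monic_finSuccEquiv hF h1).map (eval y)
  have hd : ((finSuccEquiv ℂ n F).map (eval y)).natDegree = m := by
    rw [(monic_finSuccEquiv hF h1).natDegree_map, natDegree_finSuccEquiv_eq hF h1]
  rw [eliminant, ← Polynomial.resultant_map_map]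
  have := Polynomial.resultant_eq_prod_eval ((finSuccEquiv ℂ n F).map (eval y))
    ((finSuccEquiv ℂ n G).map (eval y)) k
    (Polynomial.natDegree_map_le.trans (natDegree_finSuccEquiv_le hG))
    (IsAlgClosed.splits _)
  rw [hd, hm.leadingCoeff, one_pow, one_mul] at this
  rw [this]
  congr 2
  funext z
  rw [eval_eq_eval_mv_eval']

theorem mem_roots_finSuccEquiv (hF : F.IsHomogeneous m) (h1 : eval (Fin.cons 1 0) F = 1)
    (y : Fin n → ℂ) (z : ℂ) :
    z ∈ ((finSuccEquiv ℂ n F).map (eval y)).roots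
      ↔ eval (Fin.cons z y : Fin (n + 1) → ℂ) F = 0 := by
  rw [Polynomial.mem_roots ((monic_finSuccEquiv hF h1).map (eval y)).ne_zero,
    Polynomial.IsRoot.def, eval_eq_eval_mv_eval']

theorem eval_eliminant_eq_zero_iff (hF : F.IsHomogeneous m) (h1 : eval (Fin.cons 1 0) F = 1)
    (hG : G.IsHomogeneous k) (y : Fin n → ℂ) :
    eval y (eliminant m k F G) = 0 ↔ ∃ z : ℂ, eval (Fin.cons z y : Fin (n + 1) → ℂ) F = 0 ∧
      eval (Fin.cons z y : Fin (n + 1) → ℂ) G = 0 := by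
  rw [eval_eliminant hF h1 hG, Multiset.prod_eq_zero_iff, Multiset.mem_map]
  simp only [mem_roots_finSuccEquiv hF h1]

theorem smul_cons (a z : ℂ) (y : Fin n → ℂ) :
    (Fin.cons (a * z) (a • y) : Fin (n + 1) → ℂ) = a • (Fin.cons z y : Fin (n + 1) → ℂ) := by
  funext i
  refine Fin.cases ?_ (fun j => ?_) i <;> simp

theorem isHomogeneous_eliminant (hF : F.IsHomogeneous m) (h1 : eval (Fin.cons 1 0) F = 1)
    (hG : G.IsHomogeneous k) : (eliminant m k F G).IsHomogeneous (m * k) := by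
  have hne : ∀ (a : ℂ), a ≠ 0 → ∀ y : Fin n → ℂ,
      eval (a • y) (eliminant m k F G) = a ^ (m * k) * eval y (eliminant m k F G) := by
    intro a ha y
    have hmon := monic_finSuccEquiv hF h1
    have hroots : ((finSuccEquiv ℂ n F).map (eval (a • y))).roots
        = (((finSuccEquiv ℂ n F).map (eval y)).roots).map (a * ·) := by
      -- The polynomial over `a • y` is obtained from the one over `y` by scaling its roots by `a`.
      have hs : (finSuccEquiv ℂ n F).map (eval (a • y))
          = ((finSuccEquiv ℂ n F).map (eval y)).scaleRoots a := by
        refine Polynomial.funext fun z => ?_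
        obtain ⟨w, rfl⟩ : ∃ w, z = a * w := ⟨a⁻¹ * z, by field_simp⟩
        rw [← eval_eq_eval_mv_eval', smul_cons, eval_smul_of_isHomogeneous hF]
        have := Polynomial.scaleRoots_eval₂_mul (p := (finSuccEquiv ℂ n F).map (eval y))
          (RingHom.id ℂ) w a
        simp only [RingHom.id_apply, Polynomial.eval₂_id, hmon.natDegree_map,
          natDegree_finSuccEquiv_eq hF h1] at this
        rw [this, ← eval_eq_eval_mv_eval']
      rw [hs]
      exact Polynomial.roots_scaleRoots _ (isUnit_iff_ne_zero.mpr ha)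
    rw [eval_eliminant hF h1 hG, eval_eliminant hF h1 hG, hroots, Multiset.map_map]
    have hcard : Multiset.card ((finSuccEquiv ℂ n F).map (eval y)).roots = m := by
      rw [← (IsAlgClosed.splits _).natDegree_eq_card_roots, hmon.natDegree_map,
        natDegree_finSuccEquiv_eq hF h1]
    simp only [Function.comp_def, smul_cons, eval_smul_of_isHomogeneous hG,
      Multiset.prod_map_mul, Multiset.map_const', Multiset.prod_replicate, hcard]
    rw [← pow_mul, mul_comm k m]
  refine isHomogeneous_of_eval_smul fun a y => ?_
  -- Both sides are polynomial in `a` and agree for `a ≠ 0`.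
  have hp : lineRestrict (eliminant m k F G) 0 y
      = Polynomial.X ^ (m * k) * Polynomial.C (eval y (eliminant m k F G)) := by
    refine Polynomial.eq_of_infinite_eval_eq _ _ ?_
    refine (Set.finite_singleton (0 : ℂ)).infinite_compl.mono fun b (hb : b ≠ 0) => ?_
    simp [hne b hb y]
    ring
  have := congrArg (Polynomial.eval a) hp
  simp at this
  rw [this, mul_comm]

theorem eliminant_ne_zero (hF : F.IsHomogeneous m) (h1 : eval (Fin.cons 1 0) F = 1)
    (hG : G.IsHomogeneous k) (hp : Prime F) (hdvd : ¬ F ∣ G) : eliminant m k F G ≠ 0 := by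
  intro h0
  set S := MvPolynomial (Fin n) ℂ
  set K := FractionRing S
  have hinj : Function.Injective (algebraMap S K) := IsFractionRing.injective S K
  set f := finSuccEquiv ℂ n F
  set g := finSuccEquiv ℂ n G
  have hmon : f.Monic := monic_finSuccEquiv hF h1
  have hirr : Irreducible f := (MulEquiv.irreducible_iff (finSuccEquiv ℂ n)).mpr hp.irreducible
  have hirrK := (hmon.irreducible_iff_irreducible_map_fraction_map (K := K)).mp hirr
  have hndvd : ¬ f ∣ g := by
    rwa [map_dvd_iff]
  have hco : IsCoprime (f.map (algebraMap S K)) (g.map (algebraMap S K)) := by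
    refine (hirrK.coprime_iff_not_dvd).mpr ?_
    rwa [Polynomial.map_dvd_map _ hinj hmon]
  have hres := Polynomial.resultant_ne_zero _ _ hco
  obtain ⟨j, hj⟩ : ∃ j, k = (g.map (algebraMap S K)).natDegree + j := by
    refine ⟨k - (g.map (algebraMap S K)).natDegree, ?_⟩
    have := (Polynomial.natDegree_map_le (f := algebraMap S K) (p := g)).trans
      (natDegree_finSuccEquiv_le hG)
    omega
  have hz : Polynomial.resultant (f.map (algebraMap S K)) (g.map (algebraMap S K)) m k = 0 := by
    rw [Polynomial.resultant_map_map]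
    change algebraMap S K (eliminant m k F G) = 0
    rw [h0, map_zero]
  have hm : m = (f.map (algebraMap S K)).natDegree := by
    rw [hmon.natDegree_map, natDegree_finSuccEquiv_eq hF h1]
  rw [hj, Polynomial.resultant_add_right_deg _ _ _ _ _ le_rfl] at hz
  have hlead : (f.map (algebraMap S K)).coeff m = 1 := by
    conv_lhs => rw [hm]
    exact (hmon.map _)
  rw [hlead, one_pow, one_mul, hm] at hz
  exact hres hz

end Eliminant

/-- There is a linear change of coordinates moving a given nonzero vector to the first
coordinate vector. -/
theorem exists_linearEquiv_cons {n : ℕ} {e : Fin (n + 1) → ℂ} (he : e ≠ 0) :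
    ∃ A : (Fin (n + 1) → ℂ) ≃ₗ[ℂ] (Fin (n + 1) → ℂ), A (Fin.cons 1 0) = e := by
  have h1 : (Fin.cons 1 0 : Fin (n + 1) → ℂ) ≠ 0 := fun h => by simpa using congrFun h 0
  obtain ⟨A, hA⟩ := SeparatingDual.exists_continuousLinearEquiv_apply_eq (R := ℂ) h1 he
  exact ⟨A.toLinearEquiv, hA⟩

/-- After a linear change of coordinates, a form not vanishing at `e` becomes, up to a scalar,
monic in the first variable. -/
theorem exists_linearEquiv_eval_eq_one {n m : ℕ} {F : MvPolynomial (Fin (n + 1)) ℂ}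
    (hF : F.IsHomogeneous m) (hm : m ≠ 0) {e : Fin (n + 1) → ℂ} (he : eval e F ≠ 0) :
    ∃ (A : (Fin (n + 1) → ℂ) ≃ₗ[ℂ] (Fin (n + 1) → ℂ)) (c : ℂ), c ≠ 0 ∧
      A (Fin.cons 1 0) = e ∧ eval (Fin.cons 1 0) (C c * linSubst A.toLinearMap F) = 1 := by
  have he0 : e ≠ 0 := by
    rintro rfl
    exact he (eval_zero_of_isHomogeneous hF hm)
  obtain ⟨A, hA⟩ := exists_linearEquiv_cons he0
  exact ⟨A, (eval e F)⁻¹, inv_ne_zero he, hA, by simp [hA, he]⟩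

/-! ### Common zeros of two forms and irreducibility of smooth forms -/

/-- Two forms of positive degree in at least three variables have a common nontrivial zero. -/
theorem exists_common_zero {n m k : ℕ} {F G : MvPolynomial (Fin (n + 3)) ℂ}
    (hF : F.IsHomogeneous m) (hm : m ≠ 0) (hF0 : F ≠ 0) (hG : G.IsHomogeneous k) (hk : k ≠ 0) :
    ∃ v, v ≠ 0 ∧ eval v F = 0 ∧ eval v G = 0 := by
  obtain ⟨e, he⟩ : ∃ e, eval e F ≠ 0 := by
    by_contra! h
    exact hF0 (MvPolynomial.funext fun v => by simp [h])
  obtain ⟨A, c, hc, -, h1⟩ := exists_linearEquiv_eval_eq_one hF hm he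
  have hF' := (isHomogeneous_linSubst A.toLinearMap hF).C_mul c
  have hG' := isHomogeneous_linSubst A.toLinearMap hG
  obtain ⟨a, b, hab, hz⟩ := exists_combination_eval_eq_zero (isHomogeneous_eliminant hF' h1 hG')
    (Nat.mul_ne_zero hm hk) (Pi.single 0 1) (Pi.single 1 1)
  obtain ⟨z, hz1, hz2⟩ := (eval_eliminant_eq_zero_iff hF' h1 hG' _).mp hz
  refine ⟨A _, ?_, ?_, by simpa using hz2⟩
  · rw [Ne, LinearEquiv.map_eq_zero_iff]
    intro h
    have e1 := congrFun h (Fin.succ 0)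
    have e2 := congrFun h (Fin.succ 1)
    rw [Fin.cons_succ] at e1 e2
    simp at e1 e2
    rcases hab with hab | hab
    · exact hab e1
    · exact hab e2
  · simpa [hc] using hz1

theorem IsNonsingularForm.ne_zero {d : ℕ} {F : MvPolynomial (Fin 4) ℂ}
    (hF : IsNonsingularForm d F) : F ≠ 0 := by
  rintro rfl
  obtain ⟨i, hi⟩ := hF.2 (Pi.single 0 1) (by simp) (by simp)
  simp at hi

/-- A form with a proper factorisation is singular at a common zero of the two factors. -/
theorem IsNonsingularForm.prime {d : ℕ} {F : MvPolynomial (Fin 4) ℂ} (hd : d ≠ 0)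
    (hF : IsNonsingularForm d F) : Prime F := by
  refine Irreducible.prime ⟨fun hu => ?_, fun P Q hPQ => ?_⟩
  · rw [isUnit_iff_totalDegree_of_isReduced, hF.1.totalDegree hF.ne_zero] at hu
    exact hd hu.2
  · by_contra! hcon
    have hP0 : P ≠ 0 := by
      rintro rfl
      exact hF.ne_zero (by simpa using hPQ)
    have hQ0 : Q ≠ 0 := by
      rintro rfl
      exact hF.ne_zero (by simpa using hPQ)
    have hdeg : ∀ R : MvPolynomial (Fin 4) ℂ, R ≠ 0 → ¬ IsUnit R → R.totalDegree ≠ 0 := by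
      intro R hR hu h
      rw [totalDegree_eq_zero_iff_eq_C] at h
      refine hu ?_
      rw [h]
      refine (isUnit_iff_ne_zero.mpr fun h0 => hR ?_).map C
      rw [h, h0, C_0]
    have htop := homogeneousComponent_mul_top P Q
    rw [← totalDegree_mul_of_isDomain hP0 hQ0, ← hPQ, hF.1.totalDegree hF.ne_zero,
      homogeneousComponent_eq_self hF.1] at htop
    obtain ⟨v, hv, h1, h2⟩ := exists_common_zero
      (homogeneousComponent_isHomogeneous P.totalDegree P) (hdeg P hP0 hcon.1)
      (fun h => hF.ne_zero (by rw [htop, h, zero_mul]))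
      (homogeneousComponent_isHomogeneous Q.totalDegree Q) (hdeg Q hQ0 hcon.2)
    obtain ⟨i, hi⟩ := hF.2 v hv (by rw [htop, map_mul, h1, zero_mul])
    refine hi ?_
    rw [htop, Derivation.leibniz]
    simp [h1, h2]

/-! ### Bézout's inequality for lines in the intersection of two surfaces -/

theorem exists_dual_ker_eq {W : Submodule ℂ (Fin 3 → ℂ)} (hW : Module.finrank ℂ W = 2) :
    ∃ φ : Module.Dual ℂ (Fin 3 → ℂ), φ ≠ 0 ∧ LinearMap.ker φ = W := by
  obtain ⟨φ, hφ, hle⟩ := Submodule.exists_le_ker_of_lt_top W (lt_top_iff_ne_top.mpr fun h => by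
    rw [h, finrank_top] at hW
    simp at hW)
  refine ⟨φ, hφ, (Submodule.eq_of_le_of_finrank_eq hle ?_).symm⟩
  have := Module.Dual.finrank_ker_add_one_of_ne_zero hφ
  simp at this
  omega

/-- Bézout's inequality for lines, in coordinates where projection from the first coordinate
point is injective on the set of lines: each line projects to a line of the projective plane
on which the eliminant vanishes. -/
theorem card_lines_le_of_generic {m k : ℕ} {F G : MvPolynomial (Fin 4) ℂ}
    (hF : F.IsHomogeneous m) (h1 : eval (Fin.cons 1 0) F = 1)
    (hG : G.IsHomogeneous k) (hp : Prime F) (hdvd : ¬ F ∣ G) (T : Finset (Submodule ℂ V))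
    (hT : ∀ W ∈ T, Module.finrank ℂ W = 2)
    (hTF : ∀ W ∈ T, ∀ v ∈ W, eval v F = 0) (hTG : ∀ W ∈ T, ∀ v ∈ W, eval v G = 0)
    (hgen : ∀ W ∈ T, ∀ W' ∈ T, W ≠ W' → (Fin.cons 1 0 : V) ∈ W ⊔ W' → W ⊔ W' = ⊤) :
    T.card ≤ m * k := by
  classical
  -- The projection from the first coordinate point.
  let π : V →ₗ[ℂ] (Fin 3 → ℂ) := LinearMap.funLeft ℂ ℂ Fin.succ
  have hπ : ∀ v : V, π v = Fin.tail v := fun v => rfl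
  have hker : ∀ v : V, π v = 0 → ∃ c : ℂ, v = c • (Fin.cons 1 0 : V) := by
    intro v hv
    refine ⟨v 0, funext fun i => Fin.cases (by simp) (fun j => ?_) i⟩
    have := congrFun hv j
    rw [hπ] at this
    simpa [Fin.tail] using this
  have hinj : ∀ W ∈ T, ∀ v ∈ W, π v = 0 → v = 0 := by
    intro W hW v hv h0
    obtain ⟨c, rfl⟩ := hker v h0
    have := hTF W hW _ hv
    rw [eval_smul_of_isHomogeneous hF, h1, mul_one] at this
    rw [eq_zero_of_pow_eq_zero this, zero_smul]
  have hfin : ∀ W ∈ T, Module.finrank ℂ (W.map π) = 2 := by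
    intro W hW
    rw [← hT W hW]
    rw [← LinearMap.range_domRestrict]
    refine LinearMap.finrank_range_of_inj ((injective_iff_map_eq_zero _).mpr fun w h => ?_)
    exact Subtype.ext (hinj W hW w w.2 h)
  choose! φ hφ0 hφ using fun W hW => exists_dual_ker_eq (hfin W hW)
  have hR0 := eliminant_ne_zero hF h1 hG hp hdvd
  set R := eliminant m k F G with hR
  have hdv : ∀ W ∈ T, linearForm (φ W) ∣ R := by
    intro W hW
    refine prime_dvd_of_eval_eq_zero (prime_linearForm (hφ0 W hW)) fun y hy => ?_
    rw [eval_linearForm, ← LinearMap.mem_ker, hφ W hW] at hy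
    obtain ⟨v, hv, rfl⟩ := hy
    rw [hR, eval_eliminant_eq_zero_iff hF h1 hG]
    refine ⟨v 0, ?_⟩
    rw [hπ, Fin.cons_self_tail]
    exact ⟨hTF W hW v hv, hTG W hW v hv⟩
  have hne : ∀ W ∈ T, ∀ W' ∈ T, W ≠ W' → ¬ linearForm (φ W) ∣ linearForm (φ W') := by
    intro W hW W' hW' hWW hd
    have hle : W.map π ≤ W'.map π := by
      rw [← hφ W hW, ← hφ W' hW']
      intro y hy
      obtain ⟨Q, hQ⟩ := hd
      rw [LinearMap.mem_ker, ← eval_linearForm] at hy ⊢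
      rw [hQ, map_mul, hy, zero_mul]
    obtain ⟨w, hw, hw'⟩ : ∃ w ∈ W, w ∉ W' := by
      by_contra! h
      exact hWW (Submodule.eq_of_le_of_finrank_eq h (by rw [hT W hW, hT W' hW']))
    obtain ⟨w', hw'', he⟩ := hle (Submodule.mem_map_of_mem hw)
    obtain ⟨c, hc⟩ := hker (w - w') (by rw [map_sub, he, sub_self])
    have hc0 : c ≠ 0 := by
      rintro rfl
      rw [zero_smul, sub_eq_zero] at hc
      exact hw' (hc ▸ hw'')
    have hmem : (Fin.cons 1 0 : V) ∈ W ⊔ W' := by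
      have : (Fin.cons 1 0 : V) = c⁻¹ • (w - w') := by
        rw [hc, smul_smul, inv_mul_cancel₀ hc0, one_smul]
      rw [this]
      exact Submodule.smul_mem _ _ (Submodule.sub_mem _
        (Submodule.mem_sup_left hw) (Submodule.mem_sup_right hw''))
    have htop := hgen W hW W' hW' hWW hmem
    have hall : W'.map π = ⊤ := by
      rw [← sup_eq_right.mpr hle, ← Submodule.map_sup, htop, Submodule.map_top,
        LinearMap.range_eq_top]
      exact fun y => ⟨Fin.cons 0 y, by rw [hπ, Fin.tail_cons]⟩
    have := hfin W' hW'
    rw [hall] at this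
    simp at this
  have hprod : ∏ W ∈ T, linearForm (φ W) ∣ R := by
    refine Finset.prod_dvd_of_isRelPrime (fun W hW W' hW' hWW => ?_) hdv
    exact ((prime_linearForm (hφ0 W hW)).irreducible.isRelPrime_iff_not_dvd).mpr
      (hne W hW W' hW' hWW)
  have hhom : (∏ W ∈ T, linearForm (φ W)).IsHomogeneous (∑ _W ∈ T, 1) :=
    IsHomogeneous.prod _ _ _ fun W _ => isHomogeneous_linearForm _
  have h0 : ∏ W ∈ T, linearForm (φ W) ≠ 0 :=
    Finset.prod_ne_zero_iff.mpr fun W hW => linearForm_ne_zero (hφ0 W hW)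
  have hdeg := totalDegree_le_of_dvd_of_isDomain hprod hR0
  rw [hhom.totalDegree h0] at hdeg
  simpa using hdeg.trans (isHomogeneous_eliminant hF h1 hG).totalDegree_le

/-- A surface `F = 0` with `F` prime and a surface `G = 0` not containing it share at most
`deg F * deg G` lines. -/
theorem card_lines_le {m k : ℕ} {F G : MvPolynomial (Fin 4) ℂ}
    (hF : F.IsHomogeneous m) (hm : m ≠ 0)
    (hG : G.IsHomogeneous k) (hp : Prime F) (hdvd : ¬ F ∣ G) (T : Finset (Submodule ℂ V))
    (hT : ∀ W ∈ T, Module.finrank ℂ W = 2)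
    (hTF : ∀ W ∈ T, ∀ v ∈ W, eval v F = 0) (hTG : ∀ W ∈ T, ∀ v ∈ W, eval v G = 0) :
    T.card ≤ m * k := by
  classical
  -- A polynomial vanishing on all proper sums of two of the lines, to choose the centre of
  -- projection.
  have hpoly : ∀ U : Submodule ℂ V, ∃ P : MvPolynomial (Fin 4) ℂ, P ≠ 0 ∧
      (U ≠ ⊤ → ∀ v ∈ U, eval v P = 0) := by
    intro U
    by_cases hU : U = ⊤
    · exact ⟨1, one_ne_zero, fun h => absurd hU h⟩
    · obtain ⟨φ, hφ, hle⟩ := Submodule.exists_le_ker_of_lt_top U (lt_top_iff_ne_top.mpr hU)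
      exact ⟨linearForm φ, linearForm_ne_zero hφ, fun _ v hv => by
        rw [eval_linearForm]; exact hle hv⟩
  choose P hP0 hP using hpoly
  obtain ⟨e, he⟩ : ∃ e, eval e (F * ∏ W ∈ T, ∏ W' ∈ T, P (W ⊔ W')) ≠ 0 := by
    by_contra! h
    have h0 : F * ∏ W ∈ T, ∏ W' ∈ T, P (W ⊔ W') = 0 :=
      MvPolynomial.funext fun v => by rw [h, map_zero]
    exact mul_ne_zero hp.ne_zero (Finset.prod_ne_zero_iff.mpr fun W _ =>
      Finset.prod_ne_zero_iff.mpr fun W' _ => hP0 (W ⊔ W')) h0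
  rw [map_mul, mul_ne_zero_iff, map_prod, Finset.prod_ne_zero_iff] at he
  simp only [map_prod, Finset.prod_ne_zero_iff] at he
  obtain ⟨A, c, hc, hA, h1⟩ := exists_linearEquiv_eval_eq_one hF hm he.1
  have hmem : ∀ W : Submodule ℂ V, ∀ v, v ∈ W.comap A.toLinearMap ↔ A v ∈ W := fun W v => Iff.rfl
  have hinj : Function.Injective fun W : Submodule ℂ V => W.comap A.toLinearMap :=
    Submodule.comap_injective_of_surjective A.surjective
  have hu : IsUnit (C c : MvPolynomial (Fin 4) ℂ) := (isUnit_iff_ne_zero.mpr hc).map C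
  have hassoc : Associated (linSubst A.toLinearMap F) (C c * linSubst A.toLinearMap F) :=
    associated_unit_mul_right _ _ hu
  rw [← Finset.card_image_of_injective T hinj]
  refine card_lines_le_of_generic ((isHomogeneous_linSubst A.toLinearMap hF).C_mul c) h1
    (isHomogeneous_linSubst A.toLinearMap hG) ?_ ?_ _ ?_ ?_ ?_ ?_
  · refine hassoc.prime ?_
    rw [← linSubstEquiv_apply]
    exact (MulEquiv.prime_iff (linSubstEquiv A)).mpr hp
  · rw [← hassoc.dvd_iff_dvd_left, ← linSubstEquiv_apply, ← linSubstEquiv_apply, map_dvd_iff]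
    exact hdvd
  · simp only [Finset.forall_mem_image]
    intro W hW
    have := Submodule.comap_equiv_eq_map_symm A W
    rw [← hT W hW, ← LinearEquiv.finrank_map_eq A.symm W]
    exact congrArg (fun U : Submodule ℂ V => Module.finrank ℂ U) this
  · simp only [Finset.forall_mem_image]
    intro W hW v hv
    rw [map_mul, eval_linSubst]
    exact mul_eq_zero_of_right _ (hTF W hW _ hv)
  · simp only [Finset.forall_mem_image]
    intro W hW v hv
    rw [eval_linSubst]
    exact hTG W hW _ hv
  · simp only [Finset.forall_mem_image]
    intro W hW W' hW' hne hin
    have hsup : W.comap A.toLinearMap ⊔ W'.comap A.toLinearMap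
        = (W ⊔ W').comap A.toLinearMap := by
      have h : ∀ U : Submodule ℂ V, U.comap A.toLinearMap = U.map A.symm.toLinearMap :=
        fun U => Submodule.comap_equiv_eq_map_symm A U
      simp only [h, Submodule.map_sup]
    rw [hsup] at hin ⊢
    by_cases hU : W ⊔ W' = ⊤
    · rw [hU, Submodule.comap_top]
    · refine absurd (hP (W ⊔ W') hU e ?_) (he.2 W hW W' hW')
      rw [← hA]
      exact hin

/-! ### Finiteness of the fixed points of a homogeneous vector field -/

section FixedPoints

variable {ι : Type*} [Fintype ι] {n : ℕ} {v : ι → MvPolynomial ι ℂ}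

/-- If forms `vᵢ` of degree `n` have no common nontrivial zero, then powers of the variables are
combinations of the `vᵢ` with homogeneous coefficients. -/
theorem exists_pow_eq_sum (hv : ∀ i, (v i).IsHomogeneous n)
    (h0 : ∀ x : ι → ℂ, (∀ i, eval x (v i) = 0) → x = 0) (j : ι) :
    ∃ k : ℕ, ∃ a : ι → MvPolynomial ι ℂ, (∀ i, (a i).IsHomogeneous k) ∧
      X j ^ (k + n) = ∑ i, a i * v i := by
  have hrad : (X j : MvPolynomial ι ℂ) ∈ (Ideal.span (Set.range v)).radical := by
    rw [← vanishingIdeal_zeroLocus_eq_radical (K := ℂ), mem_vanishingIdeal_iff]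
    intro x hx
    have : x = 0 := h0 x fun i => by
      have := hx (v i) (Ideal.subset_span ⟨i, rfl⟩)
      rwa [aeval_eq_eval] at this
    simp [this]
  obtain ⟨k, hk⟩ := hrad
  have hk' : (X j : MvPolynomial ι ℂ) ^ (k + n) ∈ Ideal.span (Set.range v) := by
    rw [pow_add]
    exact Ideal.mul_mem_right _ _ hk
  obtain ⟨c, hc⟩ := Ideal.mem_span_range_iff_exists_fun.mp hk'
  refine ⟨k, fun i => homogeneousComponent k (c i),
    fun i => homogeneousComponent_isHomogeneous _ _, ?_⟩
  have hX := homogeneousComponent_eq_self (isHomogeneous_X_pow (R := ℂ) j (k + n))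
  rw [← hX, ← hc, map_sum]
  refine Finset.sum_congr rfl fun i _ => ?_
  conv_lhs => rw [← sum_homogeneousComponent (c i), Finset.sum_mul, map_sum]
  have h : ∀ l, homogeneousComponent (k + n) (homogeneousComponent l (c i) * v i)
      = if k + n = l + n then homogeneousComponent l (c i) * v i else 0 := fun l =>
    homogeneousComponent_of_mem ((homogeneousComponent_isHomogeneous l (c i)).mul (hv i))
  simp only [h, add_left_inj, Finset.sum_ite_eq, Finset.mem_range]
  split_ifs with hlt
  · rfl
  · rw [homogeneousComponent_eq_zero _ _ (by omega), zero_mul]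

/-- A system `vᵢ = xᵢ`, where the `vᵢ` are forms of degree at least two without common nontrivial
zero, has finitely many solutions: it has no solution at infinity, so its coordinate ring is
spanned by the monomials of bounded degree. -/
theorem finite_fixedPoints (hn : 2 ≤ n) (hv : ∀ i, (v i).IsHomogeneous n)
    (h0 : ∀ x : ι → ℂ, (∀ i, eval x (v i) = 0) → x = 0) :
    {x : ι → ℂ | ∀ i, eval x (v i) = x i}.Finite := by
  classical
  set I : Ideal (MvPolynomial ι ℂ) := Ideal.span (Set.range fun i => v i - X i) with hI
  choose k a ha hka using exists_pow_eq_sum hv h0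
  set N := ∑ j, (k j + n) with hN
  -- Every polynomial is congruent modulo `I` to one of degree at most `N`.
  have hred : ∀ D : ℕ, ∀ p : MvPolynomial ι ℂ, p.totalDegree ≤ D →
      ∃ q : MvPolynomial ι ℂ, q.totalDegree ≤ N ∧ p - q ∈ I := by
    intro D
    induction D with
    | zero => exact fun p hp => ⟨p, hp.trans (Nat.zero_le _), by simp⟩
    | succ D ih =>
      intro p hp
      have hmono : ∀ m ∈ p.support, ∃ q : MvPolynomial ι ℂ, q.totalDegree ≤ N ∧
          monomial m (coeff m p) - q ∈ I := by
        intro m hm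
        have hmdeg : m.sum (fun _ e => e) ≤ D + 1 := (le_totalDegree hm).trans hp
        rw [Finsupp.sum_fintype _ _ (by simp)] at hmdeg
        by_cases hlarge : ∃ j, k j + n ≤ m j
        · obtain ⟨j, hj⟩ := hlarge
          set m' : ι →₀ ℕ := m - Finsupp.single j (k j + n) with hm'
          have hmm : m = m' + Finsupp.single j (k j + n) := by
            rw [hm', tsub_add_cancel_of_le]
            rwa [Finsupp.single_le_iff]
          have hdeg' : m'.sum (fun _ e => e) + (k j + n) ≤ D + 1 := by
            rw [Finsupp.sum_fintype _ _ (by simp)]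
            have : ∑ i, m i = ∑ i, m' i + (k j + n) := by
              conv_lhs => rw [hmm]
              simp [Finset.sum_add_distrib]
            omega
          have hq : (monomial m' (coeff m p) * ∑ i, a j i * X i).totalDegree ≤ D := by
            refine (totalDegree_mul _ _).trans ?_
            have h1 : (monomial m' (coeff m p)).totalDegree ≤ m'.sum (fun _ e => e) :=
              totalDegree_monomial_le m' (coeff m p)
            have h2 : (∑ i, a j i * X i).totalDegree ≤ k j + 1 :=
              IsHomogeneous.totalDegree_le
                (IsHomogeneous.sum _ _ _ fun i _ => (ha j i).mul (isHomogeneous_X ℂ i))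
            omega
          obtain ⟨q, hqN, hqI⟩ := ih _ hq
          refine ⟨q, hqN, ?_⟩
          have hsplit : monomial m (coeff m p)
              = monomial m' (coeff m p) * ∑ i, a j i * v i := by
            rw [← hka j, X_pow_eq_monomial, monomial_mul, mul_one, ← hmm]
          have hdiff : monomial m (coeff m p) - q
              = monomial m' (coeff m p) * ∑ i, a j i * (v i - X i)
                + (monomial m' (coeff m p) * ∑ i, a j i * X i - q) := by
            rw [hsplit]
            simp only [mul_sub, Finset.sum_sub_distrib]
            ring
          rw [hdiff]
          refine I.add_mem (I.mul_mem_left _ (I.sum_mem fun i _ => I.mul_mem_left _ ?_)) hqI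
          exact Ideal.subset_span ⟨i, rfl⟩
        · push Not at hlarge
          refine ⟨monomial m (coeff m p), (totalDegree_monomial_le _ _).trans ?_, by simp⟩
          rw [Finsupp.sum_fintype _ _ (by simp)]
          exact Finset.sum_le_sum fun i _ => (hlarge i).le
      choose! q hqN hqI using hmono
      refine ⟨∑ m ∈ p.support, q m, totalDegree_finsetSum_le fun m hm => hqN m hm, ?_⟩
      have hs : p - ∑ m ∈ p.support, q m = ∑ m ∈ p.support, (monomial m (coeff m p) - q m) := by
        rw [Finset.sum_sub_distrib, ← p.as_sum]
      rw [hs]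
      exact I.sum_mem fun m hm => hqI m hm
  -- Hence the coordinate ring is finite-dimensional.
  have hfin : Module.Finite ℂ (MvPolynomial ι ℂ ⧸ I) := by
    refine Module.Finite.of_surjective
      ((Ideal.Quotient.mkₐ ℂ I).toLinearMap ∘ₗ (restrictTotalDegree ι ℂ N).subtype) ?_
    intro y
    obtain ⟨p, rfl⟩ := Ideal.Quotient.mk_surjective y
    obtain ⟨q, hq, hpq⟩ := hred _ p le_rfl
    refine ⟨⟨q, (mem_restrictTotalDegree _ _ _).mpr hq⟩, ?_⟩
    exact (Ideal.Quotient.eq.mpr hpq).symm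
  -- So each coordinate is a root of a fixed nonzero polynomial.
  have hpoly : ∀ j, ∃ P : Polynomial ℂ, P ≠ 0 ∧
      ∀ x : ι → ℂ, (∀ i, eval x (v i) = x i) → P.eval (x j) = 0 := by
    intro j
    obtain ⟨P, hP, hP0⟩ := (Algebra.IsIntegral.isIntegral (R := ℂ)
      (Ideal.Quotient.mk I (X j))).isAlgebraic
    refine ⟨P, hP, fun x hx => ?_⟩
    have hmem : Polynomial.aeval (X j : MvPolynomial ι ℂ) P ∈ I := by
      rw [← Ideal.Quotient.eq_zero_iff_mem, ← hP0]
      exact (Polynomial.aeval_algHom_apply (Ideal.Quotient.mkₐ ℂ I) (X j) P).symm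
    have hle : I ≤ RingHom.ker (eval x) := by
      rw [hI, Ideal.span_le]
      rintro _ ⟨i, rfl⟩
      simp [RingHom.mem_ker, hx i]
    have := hle hmem
    rw [RingHom.mem_ker, ← aeval_eq_eval] at this
    change (aeval x) (Polynomial.aeval (X j : MvPolynomial ι ℂ) P) = 0 at this
    rw [← Polynomial.aeval_algHom_apply, aeval_X] at this
    simpa using this
  choose P hP hroot using hpoly
  refine (Set.Finite.pi fun j => (P j).roots.toFinset.finite_toSet).subset fun x hx => ?_
  simp only [Set.mem_pi, Set.mem_univ, forall_true_left, Finset.mem_coe, Multiset.mem_toFinset]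
  exact fun j => (Polynomial.mem_roots (hP j)).mpr (hroot j x hx)

end FixedPoints

/-! ### The Hamiltonian vector field of a form -/

theorem standardForm_apply (u w : V) :
    standardForm u w = u 0 * w 1 - u 1 * w 0 + u 2 * w 3 - u 3 * w 2 := by
  rw [standardForm, Matrix.toBilin'_apply']
  simp [dotProduct, Matrix.mulVec, Fin.sum_univ_four]
  ring

theorem isSymplectic_standardForm : IsSymplectic standardForm := by
  have halt : standardForm.IsAlt := fun u => by
    change standardForm u u = 0
    rw [standardForm_apply]
    ring
  have hleft : standardForm.SeparatingLeft := by
    intro u hu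
    have h0 := hu (Pi.single 0 1)
    have h1 := hu (Pi.single 1 1)
    have h2 := hu (Pi.single 2 1)
    have h3 := hu (Pi.single 3 1)
    simp [standardForm_apply] at h0 h1 h2 h3
    funext i
    fin_cases i <;> simp [h0, h1, h2, h3]
  refine ⟨halt, hleft, fun u hu => hleft u fun w => ?_⟩
  rw [← halt.neg_eq, hu, neg_zero]

/-- The Hamiltonian vector field of `F` for the standard symplectic form, as a vector of
polynomials: the field `v` with `standardForm v w = dF w`. -/
noncomputable def ham (F : MvPolynomial (Fin 4) ℂ) : Fin 4 → MvPolynomial (Fin 4) ℂ :=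
  ![pderiv 1 F, -pderiv 0 F, pderiv 3 F, -pderiv 2 F]

/-- The value of the Hamiltonian vector field of `F` at the point `x`. -/
noncomputable def hamAt (F : MvPolynomial (Fin 4) ℂ) (x : V) : V := fun i => eval x (ham F i)

theorem standardForm_hamAt (F : MvPolynomial (Fin 4) ℂ) (x w : V) :
    standardForm (hamAt F x) w = ∑ i, eval x (pderiv i F) * w i := by
  rw [standardForm_apply, Fin.sum_univ_four]
  simp [hamAt, ham]
  ring

theorem isHomogeneous_ham {d : ℕ} {F : MvPolynomial (Fin 4) ℂ} (hF : F.IsHomogeneous d)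
    (i : Fin 4) : (ham F i).IsHomogeneous (d - 1) := by
  fin_cases i
  · exact hF.pderiv
  · exact hF.pderiv.neg
  · exact hF.pderiv
  · exact hF.pderiv.neg

theorem hamAt_smul {d : ℕ} {F : MvPolynomial (Fin 4) ℂ} (hF : F.IsHomogeneous d) (a : ℂ)
    (x : V) : hamAt F (a • x) = a ^ (d - 1) • hamAt F x := by
  funext i
  rw [Pi.smul_apply, smul_eq_mul, hamAt, hamAt]
  exact eval_smul_of_isHomogeneous (isHomogeneous_ham hF i) a x

/-- Euler's identity: the radial and the Hamiltonian vector fields pair to `d F`. -/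
theorem standardForm_hamAt_self {d : ℕ} {F : MvPolynomial (Fin 4) ℂ} (hF : F.IsHomogeneous d)
    (x : V) : standardForm (hamAt F x) x = d * eval x F := by
  have := congrArg (eval x) hF.sum_X_mul_pderiv
  rw [standardForm_hamAt]
  simpa [mul_comm] using this

theorem IsNonsingularForm.eq_zero_of_hamAt {d : ℕ} (hd : d ≠ 0) {F : MvPolynomial (Fin 4) ℂ}
    (hF : IsNonsingularForm d F) {x : V} (h : hamAt F x = 0) : x = 0 := by
  by_contra hx
  have h0 : eval x F = 0 := by
    have := standardForm_hamAt_self hF.1 x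
    rw [h, map_zero, LinearMap.zero_apply] at this
    simpa [hd] using this.symm
  obtain ⟨i, hi⟩ := hF.2 x hx h0
  have := standardForm_hamAt F x (Pi.single i 1)
  rw [h, map_zero, LinearMap.zero_apply] at this
  refine hi ?_
  simpa [Pi.single_apply] using this.symm

/-- The derivation of the polynomial ring given by the Hamiltonian vector field of `F`. -/
noncomputable def hamD (F : MvPolynomial (Fin 4) ℂ) :
    Derivation ℂ (MvPolynomial (Fin 4) ℂ) (MvPolynomial (Fin 4) ℂ) :=
  mkDerivation ℂ (ham F)

@[simp]
theorem hamD_X (F : MvPolynomial (Fin 4) ℂ) (i : Fin 4) : hamD F (X i) = ham F i :=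
  mkDerivation_X _ _ _

theorem hamD_apply (F P : MvPolynomial (Fin 4) ℂ) :
    hamD F P = ∑ i, pderiv i P * ham F i := by
  have := derivation_aeval (hamD F) X P
  simpa [aeval_X_left] using this

theorem sum_pderiv_mul_ham (F : MvPolynomial (Fin 4) ℂ) : ∑ i, pderiv i F * ham F i = 0 := by
  simp [Fin.sum_univ_four, ham]
  ring

theorem hamD_self (F : MvPolynomial (Fin 4) ℂ) : hamD F F = 0 := by
  rw [hamD_apply, sum_pderiv_mul_ham]

/-- The equation `dF (D v) = 0`, with `D` the derivative along the Hamiltonian field `v`, cutting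
out the points where `v` is an asymptotic direction of the surface `F = 0`. -/
noncomputable def inflection (F : MvPolynomial (Fin 4) ℂ) : MvPolynomial (Fin 4) ℂ :=
  ∑ i, pderiv i F * hamD F (ham F i)

theorem isHomogeneous_inflection {d : ℕ} (hd : 2 ≤ d) {F : MvPolynomial (Fin 4) ℂ}
    (hF : F.IsHomogeneous d) : (inflection F).IsHomogeneous (3 * d - 4) := by
  refine IsHomogeneous.sum _ _ _ fun i _ => ?_
  have h : (hamD F (ham F i)).IsHomogeneous ((d - 1 - 1) + (d - 1)) := by
    rw [hamD_apply]
    exact IsHomogeneous.sum _ _ _ fun j _ =>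
      (isHomogeneous_ham hF i).pderiv.mul (isHomogeneous_ham hF j)
  have := (hF.pderiv (i := i)).mul h
  convert this using 1
  omega

/-! ### Expansion along the lines tangent to the Hamiltonian field -/

/-- The generic point `x + T v(x)` of the line through `x` in the Hamiltonian direction. -/
noncomputable def hamPoint (F : MvPolynomial (Fin 4) ℂ) (i : Fin 4) :
    Polynomial (MvPolynomial (Fin 4) ℂ) :=
  Polynomial.C (X i) + Polynomial.X * Polynomial.C (ham F i)

/-- The expansion of `P (x + T v(x))` in powers of `T`. -/
noncomputable def hamExpand (F P : MvPolynomial (Fin 4) ℂ) :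
    Polynomial (MvPolynomial (Fin 4) ℂ) :=
  aeval (hamPoint F) P

theorem map_hamExpand (F P : MvPolynomial (Fin 4) ℂ) (x : V) :
    (hamExpand F P).map (eval x) = lineRestrict P x (hamAt F x) := by
  rw [lineRestrict, hamExpand]
  have h := comp_aeval_apply (hamPoint F) (Polynomial.mapAlgHom (aeval x : _ →ₐ[ℂ] ℂ)) P
  refine Eq.trans ?_ (h.trans ?_)
  · rfl
  · congr 2
    funext i
    simp [hamPoint, hamAt, Polynomial.coe_mapAlgHom]

theorem coeff_zero_hamExpand (F P : MvPolynomial (Fin 4) ℂ) : (hamExpand F P).coeff 0 = P := by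
  refine MvPolynomial.funext fun x => ?_
  have := congrArg (Polynomial.coeff · 0) (map_hamExpand F P x)
  simpa [Polynomial.coeff_zero_eq_eval_zero (lineRestrict _ _ _)] using this

/-- The derivation `hamD F` applied to the coefficients of a polynomial in `T`. -/
noncomputable def hamDCoeff (F : MvPolynomial (Fin 4) ℂ) :
    Derivation ℂ (Polynomial (MvPolynomial (Fin 4) ℂ)) (Polynomial (MvPolynomial (Fin 4) ℂ)) :=
  PolynomialModule.equivPolynomialSelf.compDer (hamD F).mapCoeffs

theorem coeff_hamDCoeff (F : MvPolynomial (Fin 4) ℂ) (p : Polynomial (MvPolynomial (Fin 4) ℂ))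
    (n : ℕ) : (hamDCoeff F p).coeff n = hamD F (p.coeff n) := rfl

theorem hamDCoeff_hamPoint (F : MvPolynomial (Fin 4) ℂ) (i : Fin 4) :
    hamDCoeff F (hamPoint F i) = Polynomial.C (ham F i)
      + Polynomial.X * Polynomial.C (hamD F (ham F i)) := by
  refine Polynomial.ext fun n => ?_
  rw [coeff_hamDCoeff, hamPoint]
  rcases n with - | n
  · simp
  · simp only [Polynomial.coeff_add, Polynomial.coeff_X_mul, Polynomial.coeff_C,
      Nat.succ_ne_zero, if_false, zero_add]
    split_ifs <;> simp

theorem derivative_hamExpand (F : MvPolynomial (Fin 4) ℂ) :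
    Polynomial.derivative (hamExpand F F)
      = ∑ i, hamExpand F (pderiv i F) * Polynomial.C (ham F i) := by
  have := derivation_aeval ((Polynomial.derivative' (R := MvPolynomial (Fin 4) ℂ)).restrictScalars ℂ)
    (hamPoint F) F
  simpa [hamExpand, hamPoint] using this

theorem hamDCoeff_hamExpand (F : MvPolynomial (Fin 4) ℂ) :
    hamDCoeff F (hamExpand F F) = Polynomial.derivative (hamExpand F F)
      + Polynomial.X * ∑ i, hamExpand F (pderiv i F) * Polynomial.C (hamD F (ham F i)) := by
  have := derivation_aeval (hamDCoeff F) (hamPoint F) F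
  rw [derivative_hamExpand, hamExpand, this, Finset.mul_sum, ← Finset.sum_add_distrib]
  refine Finset.sum_congr rfl fun i _ => ?_
  rw [hamDCoeff_hamPoint, hamExpand]
  ring

/-- Euler's identity along the line `x + T v(x)`. -/
theorem sum_hamExpand_mul_X {d : ℕ} {F : MvPolynomial (Fin 4) ℂ} (hF : F.IsHomogeneous d) :
    ∑ i, hamExpand F (pderiv i F) * Polynomial.C (X i)
      = (d : Polynomial (MvPolynomial (Fin 4) ℂ)) * hamExpand F F
        - Polynomial.X * Polynomial.derivative (hamExpand F F) := by
  have h := congrArg (aeval (hamPoint F)) hF.sum_X_mul_pderiv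
  simp only [map_sum, map_mul, aeval_X, map_nsmul] at h
  rw [derivative_hamExpand, Finset.mul_sum, eq_sub_iff_add_eq, ← Finset.sum_add_distrib]
  rw [← nsmul_eq_mul]
  refine Eq.trans (Finset.sum_congr rfl fun i _ => ?_) h
  rw [hamExpand, hamPoint]
  ring

/-- The inflection polynomial is, up to the factor `-2`, the second coefficient of the
expansion of `F (x + T v(x))`. -/
theorem inflection_eq (F : MvPolynomial (Fin 4) ℂ) :
    inflection F = -2 * (hamExpand F F).coeff 2 := by
  have h := congrArg (Polynomial.coeff · 1) (hamDCoeff_hamExpand F)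
  have h1 : (hamExpand F F).coeff 1 = 0 := by
    have := congrArg (Polynomial.coeff · 0) (derivative_hamExpand F)
    simpa [Polynomial.coeff_derivative, coeff_zero_hamExpand, sum_pderiv_mul_ham] using this
  simp only [coeff_hamDCoeff, h1, map_zero, Polynomial.coeff_add, Polynomial.coeff_derivative,
    Polynomial.coeff_X_mul _ 0, Polynomial.finsetSum_coeff, Polynomial.coeff_mul_C,
    coeff_zero_hamExpand] at h
  rw [inflection]
  push_cast at h
  linear_combination -h

/-! ### Lagrangian planes in the cone over a surface -/

section Lagrangian

variable {F : MvPolynomial (Fin 4) ℂ} {W : Submodule ℂ V}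

/-- The Hamiltonian field of `F` is tangent to every Lagrangian plane on which `F` vanishes. -/
theorem hamAt_mem_of_lagrangian (hW : Module.finrank ℂ W = 2)
    (hiso : ∀ u ∈ W, ∀ w ∈ W, standardForm u w = 0) (hWF : ∀ w ∈ W, eval w F = 0)
    {x : V} (hx : x ∈ W) : hamAt F x ∈ W := by
  have horth : LinearMap.BilinForm.orthogonal standardForm W = W := by
    have hle : W ≤ LinearMap.BilinForm.orthogonal standardForm W :=
      fun w hw u hu => hiso u hu w hw
    refine (Submodule.eq_of_le_of_finrank_eq hle ?_).symm
    rw [LinearMap.BilinForm.finrank_orthogonal isSymplectic_standardForm.2, hW]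
    simp
  rw [← horth]
  intro w hw
  have h0 : lineRestrict F x w = 0 := Polynomial.funext fun t => by
    simp [hWF _ (W.add_mem hx (W.smul_mem t hw))]
  have h1 := derivative_lineRestrict F x w
  rw [h0, map_zero] at h1
  have h2 := congrArg (Polynomial.eval 0) h1
  simp only [Polynomial.eval_zero, Polynomial.eval_finsetSum, Polynomial.eval_mul,
    eval_lineRestrict, zero_smul, add_zero, Polynomial.eval_C] at h2
  change standardForm w (hamAt F x) = 0
  rw [← isSymplectic_standardForm.1.neg_eq, standardForm_hamAt, ← h2, neg_zero]

theorem inflection_eq_zero_of_lagrangian (hW : Module.finrank ℂ W = 2)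
    (hiso : ∀ u ∈ W, ∀ w ∈ W, standardForm u w = 0) (hWF : ∀ w ∈ W, eval w F = 0)
    {x : V} (hx : x ∈ W) : eval x (inflection F) = 0 := by
  have hv := hamAt_mem_of_lagrangian hW hiso hWF hx
  have h0 : lineRestrict F x (hamAt F x) = 0 := Polynomial.funext fun t => by
    simp [hWF _ (W.add_mem hx (W.smul_mem t hv))]
  have h1 := congrArg (Polynomial.coeff · 2) (map_hamExpand F F x)
  simp only [Polynomial.coeff_map, h0, Polynomial.coeff_zero] at h1
  rw [inflection_eq, map_mul, h1, mul_zero]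

end Lagrangian

/-! ### Surfaces on which the Hamiltonian field is everywhere asymptotic -/

/-- The minors `xᵢ vⱼ - xⱼ vᵢ` of the radial and the Hamiltonian vector fields. -/
noncomputable def hamMinor (F : MvPolynomial (Fin 4) ℂ) (i j : Fin 4) : MvPolynomial (Fin 4) ℂ :=
  X i * ham F j - X j * ham F i

theorem isHomogeneous_hamMinor {d : ℕ} (hd : d ≠ 0) {F : MvPolynomial (Fin 4) ℂ}
    (hF : F.IsHomogeneous d) (i j : Fin 4) : (hamMinor F i j).IsHomogeneous d := by
  have h : ∀ a b, (X a * ham F b).IsHomogeneous d := fun a b => by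
    have := (isHomogeneous_X ℂ a).mul (isHomogeneous_ham hF b)
    rwa [Nat.add_sub_cancel' (Nat.one_le_iff_ne_zero.mpr hd)] at this
  exact (h i j).sub (h j i)

/-- In a four-dimensional symplectic space, three pairwise orthogonal vectors are linearly
dependent; here in the form of their `3 × 3` minors, modulo an element `f`. -/
theorem dvd_minor_of_dvd_symplectic {R : Type*} [CommRing R] {f : R} {x v w : Fin 4 → R}
    (h1 : f ∣ x 0 * v 1 - x 1 * v 0 + x 2 * v 3 - x 3 * v 2)
    (h2 : f ∣ x 0 * w 1 - x 1 * w 0 + x 2 * w 3 - x 3 * w 2)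
    (h3 : f ∣ v 0 * w 1 - v 1 * w 0 + v 2 * w 3 - v 3 * w 2) (i j k : Fin 4) :
    f ∣ (x i * v j - x j * v i) * w k
      - (x k * (v j * w i - v i * w j) + v k * (x i * w j - x j * w i)) := by
  obtain ⟨a, ha⟩ := h1
  obtain ⟨b, hb⟩ := h2
  obtain ⟨c, hc⟩ := h3
  -- The minors omitting one index of a symplectic pair.
  obtain ⟨p, hp⟩ : ∃ p, (x 0 * v 1 - x 1 * v 0) * w 2
      - (x 2 * (v 1 * w 0 - v 0 * w 1) + v 2 * (x 0 * w 1 - x 1 * w 0)) = f * p :=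
    ⟨a * w 2 + c * x 2 - b * v 2, by linear_combination w 2 * ha + x 2 * hc - v 2 * hb⟩
  obtain ⟨q, hq⟩ : ∃ q, (x 0 * v 1 - x 1 * v 0) * w 3
      - (x 3 * (v 1 * w 0 - v 0 * w 1) + v 3 * (x 0 * w 1 - x 1 * w 0)) = f * q :=
    ⟨a * w 3 + c * x 3 - b * v 3, by linear_combination w 3 * ha + x 3 * hc - v 3 * hb⟩
  obtain ⟨r, hr⟩ : ∃ r, (x 2 * v 3 - x 3 * v 2) * w 0
      - (x 0 * (v 3 * w 2 - v 2 * w 3) + v 0 * (x 2 * w 3 - x 3 * w 2)) = f * r :=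
    ⟨a * w 0 + c * x 0 - b * v 0, by linear_combination w 0 * ha + x 0 * hc - v 0 * hb⟩
  obtain ⟨s, hs⟩ : ∃ s, (x 2 * v 3 - x 3 * v 2) * w 1
      - (x 1 * (v 3 * w 2 - v 2 * w 3) + v 1 * (x 2 * w 3 - x 3 * w 2)) = f * s :=
    ⟨a * w 1 + c * x 1 - b * v 1, by linear_combination w 1 * ha + x 1 * hc - v 1 * hb⟩
  fin_cases i <;> fin_cases j <;> fin_cases k <;>
    simp only [Fin.zero_eta, Fin.mk_one, Fin.reduceFinMk] <;>
    first
    | exact ⟨0, by ring1⟩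
    | exact ⟨p, by linear_combination (norm := ring1) hp⟩
    | exact ⟨-p, by linear_combination (norm := ring1) -hp⟩
    | exact ⟨q, by linear_combination (norm := ring1) hq⟩
    | exact ⟨-q, by linear_combination (norm := ring1) -hq⟩
    | exact ⟨r, by linear_combination (norm := ring1) hr⟩
    | exact ⟨-r, by linear_combination (norm := ring1) -hr⟩
    | exact ⟨s, by linear_combination (norm := ring1) hs⟩
    | exact ⟨-s, by linear_combination (norm := ring1) -hs⟩

theorem symplectic_relations {d : ℕ} {F : MvPolynomial (Fin 4) ℂ} (hF : F.IsHomogeneous d)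
    (h : F ∣ inflection F) (i j k : Fin 4) :
    F ∣ hamMinor F i j * hamD F (ham F k)
      - (X k * (ham F j * hamD F (ham F i) - ham F i * hamD F (ham F j))
        + ham F k * (X i * hamD F (ham F j) - X j * hamD F (ham F i))) := by
  have heul := hF.sum_X_mul_pderiv
  have e1 : X 0 * ham F 1 - X 1 * ham F 0 + X 2 * ham F 3 - X 3 * ham F 2
      = -((d : MvPolynomial (Fin 4) ℂ) * F) := by
    rw [← nsmul_eq_mul, ← heul, Fin.sum_univ_four]
    simp [ham]
    ring
  refine dvd_minor_of_dvd_symplectic (x := X) (v := ham F) (w := fun i => hamD F (ham F i))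
    ?_ ?_ ?_ i j k
  · rw [e1]
    exact (Dvd.intro_left _ rfl).neg_right
  · have := congrArg (hamD F) e1
    simp only [map_add, map_sub, map_neg, Derivation.leibniz, hamD_X, hamD_self, smul_eq_mul,
      Derivation.map_natCast, mul_zero, add_zero, neg_zero] at this
    refine Dvd.dvd.trans (dvd_zero F) (zero_dvd_iff.mpr ?_)
    linear_combination this
  · convert h using 1
    rw [inflection, Fin.sum_univ_four]
    simp [ham]
    ring

/-- If `F` divides its inflection polynomial, then the integral curves of the Hamiltonian field
on the surface are lines: all coefficients of `F (x + T v(x))` vanish on the surface. -/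
theorem dvd_coeff_hamExpand {d : ℕ} {F : MvPolynomial (Fin 4) ℂ} (hF : F.IsHomogeneous d)
    (hp : Prime F) (h : F ∣ inflection F) {i j : Fin 4} (hij : ¬ F ∣ hamMinor F i j) (n : ℕ) :
    F ∣ (hamExpand F F).coeff n := by
  set μ := hamMinor F i j with hμ
  set α := ham F j * hamD F (ham F i) - ham F i * hamD F (ham F j) with hα
  set β := X i * hamD F (ham F j) - X j * hamD F (ham F i) with hβ
  choose r hr using symplectic_relations hF h i j
  set Φ := hamExpand F F with hΦ
  have key : Polynomial.C μ * hamDCoeff F Φ = Polynomial.C μ * Polynomial.derivative Φ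
      + Polynomial.X * (Polynomial.C α * ((d : Polynomial (MvPolynomial (Fin 4) ℂ)) * Φ
          - Polynomial.X * Polynomial.derivative Φ)
        + Polynomial.C β * Polynomial.derivative Φ)
      + Polynomial.C F * (Polynomial.X
        * ∑ k, hamExpand F (pderiv k F) * Polynomial.C (r k)) := by
    have hk : ∀ k, Polynomial.C μ * Polynomial.C (hamD F (ham F k))
        = Polynomial.C α * Polynomial.C (X k) + Polynomial.C β * Polynomial.C (ham F k)
          + Polynomial.C F * Polynomial.C (r k) := by
      intro k
      simp only [← Polynomial.C_mul, ← Polynomial.C_add]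
      congr 1
      linear_combination hr k
    have hs : Polynomial.C μ
          * ∑ k, hamExpand F (pderiv k F) * Polynomial.C (hamD F (ham F k))
        = Polynomial.C α * ∑ k, hamExpand F (pderiv k F) * Polynomial.C (X k)
          + Polynomial.C β * ∑ k, hamExpand F (pderiv k F) * Polynomial.C (ham F k)
          + Polynomial.C F * ∑ k, hamExpand F (pderiv k F) * Polynomial.C (r k) := by
      simp only [Finset.mul_sum, ← Finset.sum_add_distrib]
      refine Finset.sum_congr rfl fun k _ => ?_
      linear_combination hamExpand F (pderiv k F) * hk k
    rw [sum_hamExpand_mul_X hF, ← derivative_hamExpand] at hs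
    rw [hΦ, hamDCoeff_hamExpand]
    linear_combination Polynomial.X * hs
  -- Comparison of the coefficients of `T ^ n`.
  have hstep : ∀ n, (∀ k ≤ n, F ∣ Φ.coeff k) → F ∣ Φ.coeff (n + 1) := by
    intro n hn
    have hDn : F ∣ hamD F (Φ.coeff n) := by
      obtain ⟨q, hq⟩ := hn n le_rfl
      rw [hq, Derivation.leibniz, hamD_self, smul_zero, add_zero]
      exact Dvd.intro _ rfl
    have hc := congrArg (Polynomial.coeff · n) key
    have hX : ∀ m : ℕ, (Polynomial.X * Polynomial.derivative Φ).coeff m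
        = (m : MvPolynomial (Fin 4) ℂ) * Φ.coeff m := by
      intro m
      rcases m with - | m
      · simp
      · rw [Polynomial.coeff_X_mul, Polynomial.coeff_derivative]
        push_cast
        ring
    have hlow : F ∣ (Polynomial.X * (Polynomial.C α *
          ((d : Polynomial (MvPolynomial (Fin 4) ℂ)) * Φ
          - Polynomial.X * Polynomial.derivative Φ)
        + Polynomial.C β * Polynomial.derivative Φ)).coeff n := by
      rcases n with - | n
      · simp
      · rw [Polynomial.coeff_X_mul, Polynomial.coeff_add, Polynomial.coeff_C_mul,
          Polynomial.coeff_C_mul, Polynomial.coeff_sub, hX, Polynomial.coeff_natCast_mul,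
          Polynomial.coeff_derivative]
        have h1 := hn n (by omega)
        have h2 := hn (n + 1) le_rfl
        exact dvd_add ((dvd_sub (h1.mul_left _) (h1.mul_left _)).mul_left _)
          ((h2.mul_right _).mul_left _)
    rw [Polynomial.coeff_add, Polynomial.coeff_add, Polynomial.coeff_C_mul, Polynomial.coeff_C_mul,
      Polynomial.coeff_C_mul, coeff_hamDCoeff, Polynomial.coeff_derivative] at hc
    have hmain : F ∣ μ * (Φ.coeff (n + 1) * ((n : MvPolynomial (Fin 4) ℂ) + 1)) := by
      have h1 : F ∣ μ * hamD F (Φ.coeff n) := hDn.mul_left _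
      rw [hc, add_assoc] at h1
      exact (dvd_add_left (dvd_add hlow (Dvd.intro _ rfl))).mp h1
    have hu : IsUnit ((n : MvPolynomial (Fin 4) ℂ) + 1) := by
      have : ((n : MvPolynomial (Fin 4) ℂ) + 1) = C ((n : ℂ) + 1) := by simp
      rw [this]
      exact (isUnit_iff_ne_zero.mpr (Nat.cast_add_one_ne_zero n)).map C
    exact hu.dvd_mul_right.mp ((hp.dvd_or_dvd hmain).resolve_left hij)
  induction n using Nat.strong_induction_on with
  | _ n ih =>
    rcases n with - | n
    · rw [hΦ, coeff_zero_hamExpand]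
    · exact hstep n fun k hk => ih k (by omega)

theorem exists_smul_eq_of_minors {x v : V} (hx : x ≠ 0)
    (h : ∀ i j, x i * v j - x j * v i = 0) : ∃ c : ℂ, v = c • x := by
  obtain ⟨i, hi⟩ := Function.ne_iff.mp hx
  rw [Pi.zero_apply] at hi
  refine ⟨v i / x i, funext fun j => ?_⟩
  rw [Pi.smul_apply, smul_eq_mul, div_mul_eq_mul_div, eq_div_iff hi]
  linear_combination h i j

/-- By homogeneity, a point where the Hamiltonian field is radial can be rescaled to a point
where it equals the radial field. -/
theorem exists_fixed_of_radial {d : ℕ} (hd : 3 ≤ d) {F : MvPolynomial (Fin 4) ℂ}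
    (hF : IsNonsingularForm d F) {x : V} (hx : x ≠ 0) {c : ℂ} (h : hamAt F x = c • x) :
    ∃ t : ℂ, t ≠ 0 ∧ hamAt F (t • x) = t • x := by
  have hc : c ≠ 0 := by
    rintro rfl
    rw [zero_smul] at h
    exact hx (hF.eq_zero_of_hamAt (by omega) h)
  obtain ⟨t, ht⟩ := IsAlgClosed.exists_pow_nat_eq c⁻¹ (show 0 < d - 2 by omega)
  refine ⟨t, ?_, ?_⟩
  · rintro rfl
    rw [zero_pow (by omega)] at ht
    exact inv_ne_zero hc ht.symm
  · rw [hamAt_smul hF.1, h, smul_smul, show d - 1 = d - 2 + 1 by omega, pow_succ, ht]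
    congr 1
    field_simp

/-- If the integral curves of the Hamiltonian field on the surface are lines, then each of these
lines contains a fixed point of the field, to which all points of the line are orthogonal. -/
theorem exists_fixed_orthogonal {d : ℕ} (hd : 3 ≤ d) {F : MvPolynomial (Fin 4) ℂ}
    (hF : IsNonsingularForm d F) (h : F ∣ inflection F) {x : V} (hx : x ≠ 0)
    (hFx : eval x F = 0) : ∃ z, z ≠ 0 ∧ hamAt F z = z ∧ standardForm z x = 0 := by
  have halt := isSymplectic_standardForm.1
  by_cases hpar : ∃ c : ℂ, hamAt F x = c • x
  · obtain ⟨c, hc⟩ := hpar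
    obtain ⟨t, ht, htx⟩ := exists_fixed_of_radial hd hF hx hc
    exact ⟨t • x, smul_ne_zero ht hx, htx, by simp [halt x]⟩
  · set v := hamAt F x with hv
    obtain ⟨i, j, hij⟩ : ∃ i j, x i * v j - x j * v i ≠ 0 := by
      by_contra! hcon
      exact hpar (exists_smul_eq_of_minors hx hcon)
    have hminor : ∀ y, eval y (hamMinor F i j) = y i * hamAt F y j - y j * hamAt F y i :=
      fun y => by simp [hamMinor, hamAt]
    have hndvd : ¬ F ∣ hamMinor F i j := by
      rintro ⟨q, hq⟩
      refine hij ?_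
      rw [← hminor x, hq, map_mul, hFx, zero_mul]
    have hline : lineRestrict F x v = 0 := by
      rw [← map_hamExpand]
      refine Polynomial.ext fun n => ?_
      obtain ⟨q, hq⟩ := dvd_coeff_hamExpand hF.1 (hF.prime (by omega)) h hndvd n
      rw [Polynomial.coeff_map, hq, map_mul, hFx, zero_mul, Polynomial.coeff_zero]
    have hcomb := eval_combination_eq_zero hF.1 (x := x) (v := v) fun t => by
      rw [← eval_lineRestrict, hline, Polynomial.eval_zero]
    have hvx : standardForm v x = 0 := by
      rw [hv, standardForm_hamAt_self hF.1, hFx, mul_zero]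
    have hxv : standardForm x v = 0 := by rw [← halt.neg_eq, hvx, neg_zero]
    have hli : LinearIndependent ℂ ![x, v] := by
      rw [LinearIndependent.pair_iff' hx]
      exact fun c hc => hpar ⟨c, hc.symm⟩
    have hrank : Module.finrank ℂ (Submodule.span ℂ {x, v}) = 2 := by
      have := finrank_span_eq_card hli
      rwa [Matrix.range_cons, Matrix.range_cons, Matrix.range_empty, Set.union_empty,
        Set.singleton_union, Fintype.card_fin] at this
    obtain ⟨a, b, hab, hz⟩ := exists_combination_eval_eq_zero
      (isHomogeneous_hamMinor (by omega) hF.1 i j) (by omega) x v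
    set z := a • x + b • v with hzdef
    have hz0 : z ≠ 0 := by
      intro h0
      have := LinearIndependent.pair_iff.mp hli a b h0
      tauto
    have hmem : hamAt F z ∈ Submodule.span ℂ {x, v} := by
      refine hamAt_mem_of_lagrangian hrank ?_ ?_ (Submodule.mem_span_pair.mpr ⟨a, b, rfl⟩)
      · intro u hu w hw
        obtain ⟨a1, b1, rfl⟩ := Submodule.mem_span_pair.mp hu
        obtain ⟨a2, b2, rfl⟩ := Submodule.mem_span_pair.mp hw
        simp [halt x, halt v, hvx, hxv]
      · intro w hw
        obtain ⟨a1, b1, rfl⟩ := Submodule.mem_span_pair.mp hw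
        exact hcomb a1 b1
    obtain ⟨a', b', hz'⟩ := Submodule.mem_span_pair.mp hmem
    have hdet : a * b' - b * a' = 0 := by
      rw [hminor z, ← hz', hzdef] at hz
      simp only [Pi.add_apply, Pi.smul_apply, smul_eq_mul] at hz
      have : (a * b' - b * a') * (x i * v j - x j * v i) = 0 := by linear_combination hz
      exact (mul_eq_zero.mp this).resolve_right hij
    obtain ⟨c, hc⟩ : ∃ c : ℂ, hamAt F z = c • z := by
      rw [← hz', hzdef]
      rcases hab with ha | hb
      · refine ⟨a' / a, ?_⟩
        rw [smul_add, smul_smul, smul_smul, div_mul_cancel₀ _ ha]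
        congr 2
        field_simp
        linear_combination hdet
      · refine ⟨b' / b, ?_⟩
        rw [smul_add, smul_smul, smul_smul, div_mul_cancel₀ _ hb]
        congr 2
        field_simp
        linear_combination -hdet
    obtain ⟨t, ht, htz⟩ := exists_fixed_of_radial hd hF hz0 hc
    exact ⟨t • z, smul_ne_zero ht hz0, htz, by simp [hzdef, halt x, hvx]⟩

/-- A smooth surface of degree at least three is not contained in its inflection surface:
otherwise it would be covered by the finitely many planes orthogonal to the fixed points of the
Hamiltonian field. -/
theorem not_dvd_inflection {d : ℕ} (hd : 3 ≤ d) {F : MvPolynomial (Fin 4) ℂ}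
    (hF : IsNonsingularForm d F) : ¬ F ∣ inflection F := by
  intro h
  have hfin : {z : V | ∀ i, eval z (ham F i) = z i}.Finite := by
    refine finite_fixedPoints (n := d - 1) (by omega) (isHomogeneous_ham hF.1) fun x hx => ?_
    exact hF.eq_zero_of_hamAt (by omega) (funext hx)
  have hp := hF.prime (by omega)
  have hdvd : F ∣ X 0 * ∏ z ∈ hfin.toFinset.erase 0, linearForm (standardForm z) := by
    refine prime_dvd_of_eval_eq_zero hp fun x hx => ?_
    rw [map_mul, eval_X, map_prod]
    by_cases hx0 : x = 0
    · simp [hx0]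
    · obtain ⟨z, hz0, hz, hzx⟩ := exists_fixed_orthogonal hd hF h hx0 hx
      refine mul_eq_zero_of_right _ (Finset.prod_eq_zero (i := z) ?_ ?_)
      · rw [Finset.mem_erase, Set.Finite.mem_toFinset]
        exact ⟨hz0, fun i => congrFun hz i⟩
      · rw [eval_linearForm, hzx]
  have hlin : ∀ P : MvPolynomial (Fin 4) ℂ, P.IsHomogeneous 1 → P ≠ 0 → ¬ F ∣ P := by
    intro P hP hP0 hFP
    have := totalDegree_le_of_dvd_of_isDomain hFP hP0
    rw [hF.1.totalDegree hp.ne_zero, hP.totalDegree hP0] at this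
    omega
  rcases hp.dvd_or_dvd hdvd with h0 | h0
  · exact hlin _ (isHomogeneous_X ℂ 0) (X_ne_zero 0) h0
  · obtain ⟨z, hz, hz'⟩ := hp.exists_mem_finset_dvd h0
    refine hlin _ (isHomogeneous_linearForm _) (linearForm_ne_zero fun hs => ?_) hz'
    refine (Finset.mem_erase.mp hz).1 (isSymplectic_standardForm.2.1 z fun w => ?_)
    rw [hs, LinearMap.zero_apply]

/-! ### Involutive lines as Lagrangian planes -/

/-- The Lagrangian planes in the cone over the surface `F = 0`. -/
def lagrangianPlanes (σ : LinearMap.BilinForm ℂ V) (F : MvPolynomial (Fin 4) ℂ) :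
    Set (Submodule ℂ V) :=
  {W | Module.finrank ℂ W = 2 ∧ (∀ u ∈ W, ∀ w ∈ W, σ u w = 0) ∧ ∀ w ∈ W, eval w F = 0}

theorem encard_involutiveLines {d : ℕ} (hd : d ≠ 0) {F : MvPolynomial (Fin 4) ℂ}
    (hF : F.IsHomogeneous d) (σ : LinearMap.BilinForm ℂ V) :
    (involutiveLines σ (zeroLocus F)).encard = (lagrangianPlanes σ F).encard := by
  have hpre : involutiveLines σ (zeroLocus F)
      = Projectivization.Subspace.submodule ⁻¹' lagrangianPlanes σ F := by
    ext L
    have hsub : (L : Set P3) ⊆ zeroLocus F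
        ↔ ∀ w ∈ Projectivization.Subspace.submodule L, eval w F = 0 := by
      constructor
      · intro h w hw
        by_cases hw0 : w = 0
        · rw [hw0, eval_zero_of_isHomogeneous hF hd]
        · rw [← mk_mem_zeroLocus_iff hF w hw0]
          exact h ((Projectivization.Subspace.mem_submodule_iff L hw0).mp hw)
      · intro h x hx
        induction x using Projectivization.ind with
        | h v hv =>
          rw [mk_mem_zeroLocus_iff hF v hv]
          exact h v ((Projectivization.Subspace.mem_submodule_iff L hv).mpr hx)
    simp only [involutiveLines, IsInvolutiveLine, IsLine, contactForm, lagrangianPlanes,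
      Set.mem_ofPred_eq, Set.mem_preimage, hsub, and_assoc]
  rw [hpre]
  exact Set.encard_preimage_of_bijective Projectivization.Subspace.submodule.bijective _

theorem encard_lagrangianPlanes_le {d : ℕ} (hd : 3 ≤ d) {F : MvPolynomial (Fin 4) ℂ}
    (hF : IsNonsingularForm d F) :
    (lagrangianPlanes standardForm F).encard ≤ ((3 * d ^ 2 - 4 * d : ℕ) : ℕ∞) := by
  have hbound : ∀ T : Finset (Submodule ℂ V), (T : Set (Submodule ℂ V)) ⊆
      lagrangianPlanes standardForm F → T.card ≤ 3 * d ^ 2 - 4 * d := by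
    intro T hT
    have := card_lines_le hF.1 (by omega) (isHomogeneous_inflection (by omega) hF.1)
      (hF.prime (by omega)) (not_dvd_inflection hd hF) T (fun W hW => (hT hW).1)
      (fun W hW => (hT hW).2.2)
      (fun W hW x hx => inflection_eq_zero_of_lagrangian (hT hW).1 (hT hW).2.1 (hT hW).2.2 hx)
    refine this.trans (le_of_eq ?_)
    rw [Nat.mul_sub]
    congr 1 <;> ring
  by_contra! hlt
  obtain ⟨T, hT, hcard⟩ := Set.exists_subset_encard_eq (Order.add_one_le_of_lt hlt)
  have hTfin : T.Finite := Set.finite_of_encard_eq_coe (k := 3 * d ^ 2 - 4 * d + 1)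
    (by rw [hcard]; push_cast; rfl)
  have := hbound hTfin.toFinset (by simpa using hT)
  rw [hTfin.encard_eq_coe_toFinset_card] at hcard
  have hc : hTfin.toFinset.card = 3 * d ^ 2 - 4 * d + 1 := by exact_mod_cast hcard
  omega

/-! ### Symplectic changes of coordinates -/

/-- Every symplectic form on `ℂ⁴` is the standard one in a suitable basis. -/
theorem exists_darboux {σ : LinearMap.BilinForm ℂ V} (hσ : IsSymplectic σ) :
    ∃ A : V ≃ₗ[ℂ] V, ∀ u w, σ (A u) (A w) = standardForm u w := by
  have hex : ∀ e : V, e ≠ 0 → ∃ f, σ e f = 1 := by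
    intro e he
    obtain ⟨f, hf⟩ : ∃ f, σ e f ≠ 0 := by
      by_contra! h
      exact he (hσ.2.1 e h)
    exact ⟨(σ e f)⁻¹ • f, by simp [hf]⟩
  have hanti : ∀ u w, σ u w = -σ w u := fun u w => (hσ.1.neg_eq w u).symm
  obtain ⟨f, hef⟩ := hex (Pi.single 0 1) (by simp)
  set e : V := Pi.single 0 1
  obtain ⟨e', he', he'0⟩ : ∃ e' ∈ LinearMap.ker ((σ e).prod (σ f)), e' ≠ 0 :=
    Submodule.exists_mem_ne_zero_of_ne_bot (LinearMap.ker_ne_bot_of_finrank_lt (by simp))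
  replace he' : σ e e' = 0 ∧ σ f e' = 0 := Prod.mk_eq_zero.mp he'
  obtain ⟨g, hg⟩ := hex e' he'0
  set f' := g - σ e g • f + σ f g • e with hf'
  have h1 : σ f e = -1 := by rw [hanti, hef]
  have h2 : σ e' e = 0 := by rw [hanti, he'.1, neg_zero]
  have h3 : σ e' f = 0 := by rw [hanti, he'.2, neg_zero]
  have h4 : σ e f' = 0 := by simp [hf', hef, hσ.1 e]
  have h5 : σ f f' = 0 := by simp [hf', h1, hσ.1 f]
  have h6 : σ e' f' = 1 := by simp [hf', hg, h2, h3]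
  have h7 : σ f' e = 0 := by rw [hanti, h4, neg_zero]
  have h8 : σ f' f = 0 := by rw [hanti, h5, neg_zero]
  have h9 : σ f' e' = -1 := by rw [hanti, h6]
  let A : V →ₗ[ℂ] V := Fintype.linearCombination ℂ ![e, f, e', f']
  have hA : ∀ u w, σ (A u) (A w) = standardForm u w := by
    intro u w
    simp only [A, Fintype.linearCombination_apply, Fin.sum_univ_four]
    simp [standardForm_apply, hef, he'.1, he'.2, h1, h2, h3, h4, h5, h6, h7, h8, h9,
      hσ.1 e, hσ.1 f, hσ.1 e', hσ.1 f']
    ring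
  have hinj : Function.Injective A := by
    refine (injective_iff_map_eq_zero A).mpr fun u hu => ?_
    refine isSymplectic_standardForm.2.1 u fun w => ?_
    rw [← hA, hu, map_zero, LinearMap.zero_apply]
  exact ⟨LinearEquiv.ofInjectiveEndo A hinj, hA⟩

theorem IsNonsingularForm.linSubst {d : ℕ} {F : MvPolynomial (Fin 4) ℂ}
    (hF : IsNonsingularForm d F) (A : V ≃ₗ[ℂ] V) :
    IsNonsingularForm d (linSubst A.toLinearMap F) := by
  refine ⟨isHomogeneous_linSubst _ hF.1, fun v hv h0 => ?_⟩
  rw [eval_linSubst] at h0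
  obtain ⟨i, hi⟩ := hF.2 (A v) (by simpa using hv) h0
  by_contra! hcon
  have := sum_pderiv_linSubst A.toLinearMap F v (A.symm (Pi.single i 1))
  simp only [hcon, zero_mul, Finset.sum_const_zero, LinearEquiv.coe_coe,
    LinearEquiv.apply_symm_apply] at this
  refine hi ?_
  simpa [Pi.single_apply] using this.symm

theorem encard_lagrangianPlanes_linSubst {σ τ : LinearMap.BilinForm ℂ V} (A : V ≃ₗ[ℂ] V)
    (hA : ∀ u w, σ (A u) (A w) = τ u w) (F : MvPolynomial (Fin 4) ℂ) :
    (lagrangianPlanes τ (linSubst A.toLinearMap F)).encard = (lagrangianPlanes σ F).encard := by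
  have hpre : lagrangianPlanes τ (linSubst A.toLinearMap F)
      = Submodule.orderIsoMapComap A ⁻¹' lagrangianPlanes σ F := by
    ext W
    have hmap : ∀ y, y ∈ Submodule.orderIsoMapComap A W ↔ ∃ x ∈ W, A x = y := fun y => Iff.rfl
    have hrank : Module.finrank ℂ (Submodule.orderIsoMapComap A W) = Module.finrank ℂ W :=
      LinearEquiv.finrank_map_eq A W
    simp only [lagrangianPlanes, Set.mem_preimage, Set.mem_ofPred_eq, hrank, hmap,
      forall_exists_index, and_imp, forall_apply_eq_imp_iff₂, hA, eval_linSubst,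
      LinearEquiv.coe_coe]
  rw [hpre]
  exact Set.encard_preimage_of_bijective (Submodule.orderIsoMapComap A).bijective _

/-! ### Lines on the surfaces `p(x₀, x₁) + q(x₂, x₃) = 0` -/

/-- A binary form of degree `d` without multiple zeros has `d` distinct zeros in the projective
line. Pairwise distinctness is expressed by the `2 × 2` minors of representatives. -/
theorem exists_zeros_binary {d : ℕ} (hd : d ≠ 0) {p : MvPolynomial (Fin 2) ℂ}
    (hp : p.IsHomogeneous d)
    (hsm : ∀ a, a ≠ 0 → eval a p = 0 → ∃ i, eval a (pderiv i p) ≠ 0) :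
    ∃ S : Finset (Fin 2 → ℂ), S.card = d ∧ (∀ a ∈ S, a ≠ 0 ∧ eval a p = 0) ∧
      ∀ a ∈ S, ∀ b ∈ S, a ≠ b → a 0 * b 1 - a 1 * b 0 ≠ 0 := by
  classical
  obtain ⟨u, hu⟩ : ∃ u, eval u p ≠ 0 := by
    by_contra! h
    have hp0 : p = 0 := MvPolynomial.funext fun v => by simp [h]
    obtain ⟨i, hi⟩ := hsm (Pi.single 0 1) (by simp) (h _)
    simp [hp0] at hi
  obtain ⟨w, hw⟩ : ∃ w : Fin 2 → ℂ, w 0 * u 1 - w 1 * u 0 ≠ 0 := by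
    by_contra! h
    have h0 := h (Pi.single 0 1)
    have h1 := h (Pi.single 1 1)
    simp at h0 h1
    refine hu ?_
    have : u = 0 := funext fun i => by fin_cases i <;> simp [h0, h1]
    rw [this, eval_zero_of_isHomogeneous hp hd]
  set f := lineRestrict p w u with hf
  have hdeg : f.natDegree = d :=
    Polynomial.natDegree_eq_of_le_of_coeff_ne_zero (natDegree_lineRestrict_le hp w u)
      (by rwa [coeff_lineRestrict hp])
  have hf0 : f ≠ 0 := by
    intro h0
    rw [← coeff_lineRestrict hp w u, ← hf, h0, Polynomial.coeff_zero] at hu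
    exact hu rfl
  have hnodup : f.roots.Nodup := by
    rw [Multiset.nodup_iff_count_le_one]
    intro t
    by_contra! hlt
    rw [Polynomial.count_roots, Polynomial.one_lt_rootMultiplicity_iff_isRoot hf0] at hlt
    obtain ⟨h0, h1⟩ := hlt
    rw [Polynomial.IsRoot.def, hf, eval_lineRestrict] at h0
    rw [Polynomial.IsRoot.def, hf, derivative_lineRestrict] at h1
    simp only [Polynomial.eval_mul, eval_lineRestrict, Polynomial.eval_C, Fin.sum_univ_two,
      Polynomial.eval_add] at h1
    set a := w + t • u with ha
    have hdet : a 0 * u 1 - a 1 * u 0 ≠ 0 := by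
      rw [ha]
      simp only [Pi.add_apply, Pi.smul_apply, smul_eq_mul]
      intro h
      exact hw (by linear_combination h)
    have heul := congrArg (eval a) hp.sum_X_mul_pderiv
    simp only [Fin.sum_univ_two, map_add, map_mul, eval_X, map_nsmul, h0, smul_zero] at heul
    obtain ⟨i, hi⟩ := hsm a (fun h => hdet (by simp [h])) h0
    refine hi ?_
    fin_cases i
    · have : eval a (pderiv 0 p) * (a 0 * u 1 - a 1 * u 0) = 0 := by
        linear_combination u 1 * heul - a 1 * h1
      exact (mul_eq_zero.mp this).resolve_right hdet
    · have : eval a (pderiv 1 p) * (a 0 * u 1 - a 1 * u 0) = 0 := by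
        linear_combination a 0 * h1 - u 0 * heul
      exact (mul_eq_zero.mp this).resolve_right hdet
  have hsep : ∀ s t : ℂ, (w + s • u) 0 * (w + t • u) 1 - (w + s • u) 1 * (w + t • u) 0
      = (t - s) * (w 0 * u 1 - w 1 * u 0) := by
    intro s t
    simp only [Pi.add_apply, Pi.smul_apply, smul_eq_mul]
    ring
  have hinj : Function.Injective fun t : ℂ => w + t • u := by
    intro s t hst
    have h := hsep s t
    have hst' : w + s • u = w + t • u := hst
    rw [hst', mul_comm ((w + t • u) 0), sub_self] at h
    exact (sub_eq_zero.mp ((mul_eq_zero.mp h.symm).resolve_right hw)).symm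
  refine ⟨f.roots.toFinset.image fun t => w + t • u, ?_, ?_, ?_⟩
  · rw [Finset.card_image_of_injective _ hinj, Multiset.toFinset_card_of_nodup hnodup,
      ← (IsAlgClosed.splits f).natDegree_eq_card_roots, hdeg]
  · simp only [Finset.forall_mem_image, Multiset.mem_toFinset]
    intro t ht
    have hroot := Polynomial.isRoot_of_mem_roots ht
    rw [Polynomial.IsRoot.def, hf, eval_lineRestrict] at hroot
    refine ⟨fun h0 => hw ?_, hroot⟩
    have e0 := congrFun h0 0
    have e1 := congrFun h0 1
    simp only [Pi.add_apply, Pi.smul_apply, smul_eq_mul, Pi.zero_apply] at e0 e1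
    linear_combination u 1 * e0 - u 0 * e1
  · simp only [Finset.forall_mem_image]
    intro s _ t _ hne
    rw [hsep]
    refine mul_ne_zero (sub_ne_zero.mpr ?_) hw
    rintro rfl
    exact hne rfl

theorem eval_binarySum (p q : MvPolynomial (Fin 2) ℂ) (v : V) :
    eval v (binarySum p q) = eval ![v 0, v 1] p + eval ![v 2, v 3] q := by
  rw [binarySum, map_add, eval_rename, eval_rename]
  congr 3 <;> funext i <;> fin_cases i <;> rfl

theorem sum_pderiv_binarySum (p q : MvPolynomial (Fin 2) ℂ) (v w : V) :
    ∑ i, eval v (pderiv i (binarySum p q)) * w i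
      = ∑ i, eval ![v 0, v 1] (pderiv i p) * ![w 0, w 1] i
        + ∑ i, eval ![v 2, v 3] (pderiv i q) * ![w 2, w 3] i := by
  have h : lineRestrict (binarySum p q) v w
      = lineRestrict p ![v 0, v 1] ![w 0, w 1] + lineRestrict q ![v 2, v 3] ![w 2, w 3] := by
    refine Polynomial.funext fun t => ?_
    rw [Polynomial.eval_add, eval_lineRestrict, eval_lineRestrict, eval_lineRestrict,
      eval_binarySum]
    congr 3 <;> funext i <;> fin_cases i <;> simp
  have := congrArg (fun P => Polynomial.eval 0 (Polynomial.derivative P)) h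
  simp only [Polynomial.derivative_add, derivative_lineRestrict, Polynomial.eval_add,
    Polynomial.eval_finsetSum, Polynomial.eval_mul, eval_lineRestrict, zero_smul, add_zero,
    Polynomial.eval_C] at this
  exact this

section BinarySum

variable {d : ℕ} {p q : MvPolynomial (Fin 2) ℂ}

theorem exists_pderiv_ne_zero_left (hd : 2 ≤ d) (hq : q.IsHomogeneous d)
    (h : IsNonsingularForm d (binarySum p q)) (a : Fin 2 → ℂ) (ha : a ≠ 0) (hpa : eval a p = 0) :
    ∃ i, eval a (pderiv i p) ≠ 0 := by
  have ha' : ![a 0, a 1] = a := funext fun i => by fin_cases i <;> rfl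
  have h00 : (![0, 0] : Fin 2 → ℂ) = 0 := funext fun i => by fin_cases i <;> rfl
  have hqc : constantCoeff q = 0 := by simpa using eval_zero_of_isHomogeneous hq (by omega)
  obtain ⟨i, hi⟩ := h.2 ![a 0, a 1, 0, 0]
    (fun h0 => ha (by rw [← ha']; have e0 := congrFun h0 0; have e1 := congrFun h0 1
                      simp at e0 e1; simp [e0, e1, h00]))
    (by simp [eval_binarySum, ha', h00, hpa, hqc])
  by_contra! hcon
  have hq0 : ∀ j, constantCoeff (pderiv j q) = 0 :=
    fun j => by simpa using eval_zero_of_isHomogeneous (hq.pderiv (i := j)) (by omega)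
  have := sum_pderiv_binarySum p q ![a 0, a 1, 0, 0] (Pi.single i 1)
  refine hi ?_
  simpa [Pi.single_apply, ha', h00, hcon, hq0] using this

theorem exists_pderiv_ne_zero_right (hd : 2 ≤ d) (hp : p.IsHomogeneous d)
    (h : IsNonsingularForm d (binarySum p q)) (a : Fin 2 → ℂ) (ha : a ≠ 0) (hqa : eval a q = 0) :
    ∃ i, eval a (pderiv i q) ≠ 0 := by
  have ha' : ![a 0, a 1] = a := funext fun i => by fin_cases i <;> rfl
  have h00 : (![0, 0] : Fin 2 → ℂ) = 0 := funext fun i => by fin_cases i <;> rfl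
  have hpc : constantCoeff p = 0 := by simpa using eval_zero_of_isHomogeneous hp (by omega)
  obtain ⟨i, hi⟩ := h.2 ![0, 0, a 0, a 1]
    (fun h0 => ha (by rw [← ha']; have e0 := congrFun h0 2; have e1 := congrFun h0 3
                      simp at e0 e1; simp [e0, e1, h00]))
    (by simp [eval_binarySum, ha', h00, hqa, hpc])
  by_contra! hcon
  have hp0 : ∀ j, constantCoeff (pderiv j p) = 0 :=
    fun j => by simpa using eval_zero_of_isHomogeneous (hp.pderiv (i := j)) (by omega)
  have := sum_pderiv_binarySum p q ![0, 0, a 0, a 1] (Pi.single i 1)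
  refine hi ?_
  simpa [Pi.single_apply, ha', h00, hcon, hp0] using this

/-- The plane in `ℂ⁴` joining a vector of the first and a vector of the second coordinate
plane. -/
def joinPlane (a b : Fin 2 → ℂ) : Submodule ℂ V :=
  Submodule.span ℂ {![a 0, a 1, 0, 0], ![0, 0, b 0, b 1]}

theorem mem_joinPlane {a b : Fin 2 → ℂ} {v : V} :
    v ∈ joinPlane a b ↔ ∃ s t : ℂ, v = ![s * a 0, s * a 1, t * b 0, t * b 1] := by
  rw [joinPlane, Submodule.mem_span_pair]
  refine exists_congr fun s => exists_congr fun t => ?_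
  rw [eq_comm]
  simp

/-- The lines joining the zeros of `p` and the zeros of `q` are involutive lines of the surface
`p(x₀, x₁) + q(x₂, x₃) = 0`. -/
theorem joinPlane_mem_lagrangianPlanes (hp : p.IsHomogeneous d) (hq : q.IsHomogeneous d)
    {a b : Fin 2 → ℂ} (ha : a ≠ 0) (hb : b ≠ 0) (hpa : eval a p = 0) (hqb : eval b q = 0) :
    joinPlane a b ∈ lagrangianPlanes standardForm (binarySum p q) := by
  have ha' : ∀ s : ℂ, ![s * a 0, s * a 1] = s • a :=
    fun s => funext fun i => by fin_cases i <;> rfl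
  have hb' : ∀ s : ℂ, ![s * b 0, s * b 1] = s • b :=
    fun s => funext fun i => by fin_cases i <;> rfl
  refine ⟨?_, ?_, ?_⟩
  · have hli : LinearIndependent ℂ ![(![a 0, a 1, 0, 0] : V), ![0, 0, b 0, b 1]] := by
      refine LinearIndependent.pair_iff.mpr fun s t hst => ?_
      have e0 := congrFun hst 0
      have e1 := congrFun hst 1
      have e2 := congrFun hst 2
      have e3 := congrFun hst 3
      simp at e0 e1 e2 e3
      constructor
      · by_contra hs
        refine ha (funext fun i => ?_)
        fin_cases i
        · exact e0.resolve_left hs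
        · exact e1.resolve_left hs
      · by_contra ht
        refine hb (funext fun i => ?_)
        fin_cases i
        · exact e2.resolve_left ht
        · exact e3.resolve_left ht
    have := finrank_span_eq_card hli
    rwa [Matrix.range_cons, Matrix.range_cons, Matrix.range_empty, Set.union_empty,
      Set.singleton_union, Fintype.card_fin] at this
  · intro u hu w hw
    obtain ⟨s, t, rfl⟩ := mem_joinPlane.mp hu
    obtain ⟨s', t', rfl⟩ := mem_joinPlane.mp hw
    simp [standardForm_apply]
    ring
  · intro w hw
    obtain ⟨s, t, rfl⟩ := mem_joinPlane.mp hw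
    simp [eval_binarySum, ha', hb', eval_smul_of_isHomogeneous hp, eval_smul_of_isHomogeneous hq,
      hpa, hqb]

theorem le_encard_lagrangianPlanes_binarySum (hd : 2 ≤ d) (hp : p.IsHomogeneous d)
    (hq : q.IsHomogeneous d) (h : IsNonsingularForm d (binarySum p q)) :
    ((d ^ 2 : ℕ) : ℕ∞) ≤ (lagrangianPlanes standardForm (binarySum p q)).encard := by
  obtain ⟨S, hS, hSz, hSd⟩ := exists_zeros_binary (by omega) hp (exists_pderiv_ne_zero_left hd hq h)
  obtain ⟨T, hT, hTz, hTd⟩ := exists_zeros_binary (by omega) hq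
    (exists_pderiv_ne_zero_right hd hp h)
  have hinj : Set.InjOn (fun ab : (Fin 2 → ℂ) × (Fin 2 → ℂ) => joinPlane ab.1 ab.2)
      (S ×ˢ T : Finset _) := by
    rintro ⟨a, b⟩ hab ⟨a', b'⟩ hab' heq
    simp only [Finset.coe_product, Set.mem_prod, Finset.mem_coe] at hab hab'
    simp only at heq
    have hmem : (![a' 0, a' 1, b' 0, b' 1] : V) ∈ joinPlane a b := by
      rw [heq]
      exact mem_joinPlane.mpr ⟨1, 1, by simp⟩
    obtain ⟨s, t, hst⟩ := mem_joinPlane.mp hmem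
    have e0 := congrFun hst 0
    have e1 := congrFun hst 1
    have e2 := congrFun hst 2
    have e3 := congrFun hst 3
    simp at e0 e1 e2 e3
    rw [Prod.mk.injEq]
    constructor
    · by_contra hne
      exact hSd a hab.1 a' hab'.1 hne (by rw [e0, e1]; ring)
    · by_contra hne
      exact hTd b hab.2 b' hab'.2 hne (by rw [e2, e3]; ring)
  have hsub : (fun ab : (Fin 2 → ℂ) × (Fin 2 → ℂ) => joinPlane ab.1 ab.2) ''
      (S ×ˢ T : Finset _) ⊆ lagrangianPlanes standardForm (binarySum p q) := by
    rintro _ ⟨⟨a, b⟩, hab, rfl⟩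
    simp only [Finset.coe_product, Set.mem_prod, Finset.mem_coe] at hab
    exact joinPlane_mem_lagrangianPlanes hp hq (hSz a hab.1).1 (hTz b hab.2).1 (hSz a hab.1).2
      (hTz b hab.2).2
  refine le_trans ?_ (Set.encard_le_encard hsub)
  rw [hinj.encard_image, Set.encard_coe_eq_coe_finsetCard, Finset.card_product, hS, hT, sq]

end BinarySum

/-- The Fermat surface `x₀ᵈ + x₁ᵈ + x₂ᵈ + x₃ᵈ = 0` is smooth. -/
theorem isNonsingularForm_fermat {d : ℕ} (hd : d ≠ 0) :
    IsNonsingularForm d (binarySum (X 0 ^ d + X 1 ^ d) (X 0 ^ d + X 1 ^ d)) := by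
  have hX : binarySum (X 0 ^ d + X 1 ^ d) (X 0 ^ d + X 1 ^ d) = ∑ i, X i ^ d := by
    simp [binarySum, Fin.sum_univ_four]
    ring
  rw [hX]
  refine ⟨IsHomogeneous.sum _ _ _ fun i _ => isHomogeneous_X_pow i d, fun v hv _ => ?_⟩
  obtain ⟨i, hi⟩ := Function.ne_iff.mp hv
  refine ⟨i, ?_⟩
  have : pderiv i (∑ j, X j ^ d : MvPolynomial (Fin 4) ℂ) = C (d : ℂ) * X i ^ (d - 1) := by
    rw [map_sum, Finset.sum_eq_single i]
    · rw [Derivation.leibniz_pow, pderiv_X_self]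
      simp
    · intro j _ hji
      rw [Derivation.leibniz_pow, pderiv_X_of_ne hji]
      simp
    · simp
  rw [this]
  simp [hd]
  exact fun h => absurd h hi

/-! ### The bounds for an arbitrary symplectic form -/

section Bounds

variable {σ : LinearMap.BilinForm ℂ V}

theorem encard_involutiveLines_le (hσ : IsSymplectic σ) {d : ℕ} (hd : 3 ≤ d) {X : Set P3}
    (hX : IsSmoothSurface d X) :
    (involutiveLines σ X).encard ≤ ((3 * d ^ 2 - 4 * d : ℕ) : ℕ∞) := by
  obtain ⟨F, hF, rfl⟩ := hX
  obtain ⟨A, hA⟩ := exists_darboux hσ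
  rw [encard_involutiveLines (by omega) hF.1, ← encard_lagrangianPlanes_linSubst A hA]
  exact encard_lagrangianPlanes_le hd (hF.linSubst A)

theorem maxInvolutiveLines_le (hσ : IsSymplectic σ) {d : ℕ} (hd : 3 ≤ d) :
    maxInvolutiveLines σ d ≤ ((3 * d ^ 2 - 4 * d : ℕ) : ℕ∞) :=
  iSup₂_le fun _ hX => encard_involutiveLines_le hσ hd hX

/-- The lower bound is realised by the Fermat surface in Darboux coordinates. -/
theorem le_maxInvolutiveLines (hσ : IsSymplectic σ) {d : ℕ} (hd : 3 ≤ d) :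
    ((d ^ 2 : ℕ) : ℕ∞) ≤ maxInvolutiveLines σ d := by
  obtain ⟨A, hA⟩ := exists_darboux hσ
  have hp : (X 0 ^ d + X 1 ^ d : MvPolynomial (Fin 2) ℂ).IsHomogeneous d :=
    (isHomogeneous_X_pow 0 d).add (isHomogeneous_X_pow 1 d)
  have hF := isNonsingularForm_fermat (d := d) (by omega)
  set F := binarySum (X 0 ^ d + X 1 ^ d) (X 0 ^ d + X 1 ^ d) with hFdef
  have hF' := hF.linSubst A.symm
  have hback : linSubst A.toLinearMap (linSubst A.symm.toLinearMap F) = F :=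
    MvPolynomial.funext fun v => by simp
  refine le_trans ?_ (le_iSup₂ (f := fun (X : Set P3) (_ : IsSmoothSurface d X) =>
    (involutiveLines σ X).encard) _ ⟨_, hF', rfl⟩)
  rw [encard_involutiveLines (by omega) hF'.1, ← encard_lagrangianPlanes_linSubst A hA, hback]
  exact le_encard_lagrangianPlanes_binarySum (by omega) hp hp hF

theorem limsup_maxInvolutiveLines_mem (hσ : IsSymplectic σ) :
    Filter.limsup
      (fun d : ℕ => (maxInvolutiveLines σ d : ℝ≥0∞) / (d : ℝ≥0∞) ^ 2) Filter.atTop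
        ∈ Set.Icc (1 : ℝ≥0∞) 3 := by
  have hne : ∀ d : ℕ, 3 ≤ d → ((d : ℝ≥0∞) ^ 2 ≠ 0 ∧ (d : ℝ≥0∞) ^ 2 ≠ ⊤) := fun d hd =>
    ⟨pow_ne_zero 2 (Nat.cast_ne_zero.mpr (by omega)), ENNReal.pow_ne_top (ENNReal.natCast_ne_top d)⟩
  constructor
  · refine Filter.le_limsup_of_frequently_le (Filter.Eventually.frequently ?_)
    filter_upwards [Filter.eventually_ge_atTop 3] with d hd
    rw [ENNReal.le_div_iff_mul_le (Or.inl (hne d hd).1) (Or.inl (hne d hd).2), one_mul]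
    have := ENat.toENNReal_le.mpr (le_maxInvolutiveLines hσ hd)
    simpa using this
  · refine Filter.limsup_le_of_le (h := ?_)
    filter_upwards [Filter.eventually_ge_atTop 3] with d hd
    rw [ENNReal.div_le_iff (hne d hd).1 (hne d hd).2]
    have h1 : maxInvolutiveLines σ d ≤ ((3 * d ^ 2 : ℕ) : ℕ∞) :=
      (maxInvolutiveLines_le hσ hd).trans (Nat.cast_le.mpr (Nat.sub_le _ _))
    have := ENat.toENNReal_le.mpr h1
    simpa using this

end Bounds

end InvolutiveLines

theorem theorem2 :
    (∀ σ : LinearMap.BilinForm ℂ InvolutiveLines.V, InvolutiveLines.IsSymplectic σ →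
      (∀ d : ℕ, 3 ≤ d → ∀ X : Set InvolutiveLines.P3, InvolutiveLines.IsSmoothSurface d X →
        (InvolutiveLines.involutiveLines σ X).encard ≤ ((3 * d ^ 2 - 4 * d : ℕ) : ℕ∞)) ∧
      (∀ d : ℕ, 3 ≤ d →
        ((d ^ 2 : ℕ) : ℕ∞) ≤ InvolutiveLines.maxInvolutiveLines σ d ∧
        InvolutiveLines.maxInvolutiveLines σ d ≤ ((3 * d ^ 2 - 4 * d : ℕ) : ℕ∞)) ∧
      Filter.limsup
        (fun d : ℕ => (InvolutiveLines.maxInvolutiveLines σ d : ℝ≥0∞) / (d : ℝ≥0∞) ^ 2)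
        Filter.atTop ∈ Set.Icc (1 : ℝ≥0∞) 3) ∧
    (∀ d : ℕ, 3 ≤ d → ∀ p q : MvPolynomial (Fin 2) ℂ, p.IsHomogeneous d → q.IsHomogeneous d →
      InvolutiveLines.IsNonsingularForm d (InvolutiveLines.binarySum p q) →
      ((d ^ 2 : ℕ) : ℕ∞) ≤
        (InvolutiveLines.involutiveLines InvolutiveLines.standardForm
          (InvolutiveLines.zeroLocus (InvolutiveLines.binarySum p q))).encard) := by
  refine ⟨fun σ hσ => ⟨fun d hd X hX => InvolutiveLines.encard_involutiveLines_le hσ hd hX,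
    fun d hd => ⟨InvolutiveLines.le_maxInvolutiveLines hσ hd,
      InvolutiveLines.maxInvolutiveLines_le hσ hd⟩,
    InvolutiveLines.limsup_maxInvolutiveLines_mem hσ⟩, fun d hd p q hp hq h => ?_⟩
  rw [InvolutiveLines.encard_involutiveLines (by omega) h.1]
  exact InvolutiveLines.le_encard_lagrangianPlanes_binarySum (by omega) hp hq h
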